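/- Let $(X,g)$ be a smooth oriented Riemannian four-manifold, $\Lambda^2=\Lambda^+\oplus\Lambda^-$ the splitting of the bundle of 2-forms into self-dual and anti-self-dual forms, each of $\Lambda^\pm$ being an $SO(3)$-bundle with the metric connection induced by the Levi-Civita connection of $g$. Call a metric whose sectional curvatures all have the same sign pointwise $K$-pinched if at every point $p$ one has $\min_p|\sec|/\max_p|\sec|>K$, the minimum and the maximum being over the two-planes in $T_pX$. A metric connection in an $SO(3)$-bundle $E\to X$ has a curvature $F$, a 2-form with values in $\mathfrak{so}(E)$, which at each point is viewed as a map $F\colon\mathfrak{so}(E)^*\to\Lambda^2$. The connection is called definite if at every point the image of $F$ is a maximal definite subspace of $\Lambda^2$ for the wedge product $\Lambda^2\times\Lambda^2\to\Lambda^4$. In that case there are a unique orientation and conformal class on $X$ for which the image of $F$ is the bundle of self-dual forms. A metric in this class gives $\Lambda^2\cong\mathfrak{so}(TX)$, $a\wedge b\mapsto\bigl(v\mapsto b(v)a^\sharp-a(v)b^\sharp\bigr)$, so that the image of $F$ is oriented as a summand of $\mathfrak{so}(TX)$ isomorphic to $\mathfrak{so}(3)$. Here $\mathfrak{so}(3)$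 has the orientation for which a basis $u,v,w$ is positive when $u,v,[u,v]$ has the same orientation as $u,v,w$, and $\mathfrak{so}(E)^*$ has the dual orientation. The definite connection is called positive definite if $F$ is orientation preserving onto its image and negative definite if $F$ is orientation reversing. (Sign convention: $F(u,v)=\nabla_u\nabla_v-\nabla_v\nabla_u-\nabla_{[u,v]}$.) **Theorem.** 1. If all sectional curvatures of $g$ are positive and $g$ is pointwise $2/5$-pinched, then the induced connections on $\Lambda^+$ and on $\Lambda^-$ are both positive definite. 2. If all sectional curvatures of $g$ are negative and $g$ is pointwise $2/5$-pinched, then the induced connections on $\Lambda^+$ and on $\Lambda^-$ are both negative definite. 3. In each case the constant $2/5$ is optimal: for every $K<2/5$ there is an oriented Riemannian four-manifold with positive (respectively negative) sectional curvatures that is pointwise $K$-pinched, for which the induced connections on $\Lambda^+$ and $\Lambda^-$ are not both positive (respectively negative) definite. (The manifold is not required to be compact or complete.) -/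

import Mathlib

open scoped Manifold ContDiff Topology

noncomputable section

namespace PinchedConnections

/-- The model space `ℝ⁴`. -/
abbrev E4 : Type := EuclideanSpace ℝ (Fin 4)

/-- Bilinear forms on `ℝ⁴`; the exterior 2-forms are the alternating ones. -/
abbrev Bil : Type := LinearMap.BilinForm ℝ E4

/-! ### Riemannian geometry in coordinates -/

section Coordinates

/-- A metric in coordinates: `G y v w = g_y(v, w)`. -/
abbrev CoordMetric : Type := E4 → E4 →L[ℝ] E4 →L[ℝ] ℝ

/-- The linear form `w ↦ ½ (∂_u g(v, w) + ∂_v g(u, w) - ∂_w g(u, v))` at `y`. -/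
def christoffelLower (G : CoordMetric) (y u v : E4) : E4 →L[ℝ] ℝ :=
  (1 / 2 : ℝ) • (fderiv ℝ G y u v + fderiv ℝ G y v u - ((fderiv ℝ G y).flip u).flip v)

/-- The Christoffel symbols `Γ_y(u, v) = ∇_u v` of the Levi-Civita connection, obtained from
`christoffelLower` by raising the index: `g_y(Γ_y(u, v), w) = christoffelLower G y u v w`. -/
def christoffel (G : CoordMetric) (y u v : E4) : E4 :=
  (G y).inverse (christoffelLower G y u v)

/-- The Levi-Civita covariant derivative `∇_u W` of a vector field `W`, in the direction of the
coordinate vector field with constant coefficients `u`. -/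
def nablaVec (G : CoordMetric) (u : E4) (W : E4 → E4) : E4 → E4 :=
  fun y => fderiv ℝ W y u + christoffel G y u (W y)

/-- The connection induced on covariant 2-tensors, in particular on 2-forms:
`(∇_u Ω)(a, b) = ∂_u (Ω(a, b)) - Ω(∇_u a, b) - Ω(a, ∇_u b)` for coordinate fields `a`, `b`. -/
def nablaForm (G : CoordMetric) (u : E4) (Ω : E4 → E4 → E4 → ℝ) : E4 → E4 → E4 → ℝ :=
  fun y a b => fderiv ℝ (fun z => Ω z a b) y u
    - Ω y (christoffel G y u a) b - Ω y a (christoffel G y u b)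

/-- The Riemann curvature `R(u, v)w = ∇_u ∇_v w - ∇_v ∇_u w` at `y`. The coordinate fields `u`, `v`
commute, so there is no bracket term. -/
def riemann (G : CoordMetric) (y u v w : E4) : E4 :=
  nablaVec G u (nablaVec G v fun _ => w) y - nablaVec G v (nablaVec G u fun _ => w) y

/-- The curvature `F(u, v)α = ∇_u ∇_v α - ∇_v ∇_u α` at `y` of the induced connection on
2-forms. -/
def formCurvature (G : CoordMetric) (y u v : E4) (α : Bil) : E4 → E4 → ℝ :=
  nablaForm G u (nablaForm G v fun _ a b => α a b) y
    - nablaForm G v (nablaForm G u fun _ a b => α a b) y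

/-- The sectional curvature at `y` of the plane spanned by `u` and `v`. -/
def sectional (G : CoordMetric) (y u v : E4) : ℝ :=
  G y (riemann G y u v v) u / (G y u u * G y v v - G y u v ^ 2)

end Coordinates

/-! ### 2-forms on a four-dimensional vector space -/

section Forms

/-- The 2-forms `α` with `⋆α = ε α`, where `⋆` is the Hodge star of the inner product and the
orientation for which `e` is an oriented orthonormal basis. So `ε = 1` gives `Λ⁺` and `ε = -1`
gives `Λ⁻`. -/
def dualForms (e : Module.Basis (Fin 4) ℝ E4) (ε : ℝ) : Submodule ℝ Bil where
  carrier := {α | (∀ v, α v v = 0) ∧ α (e 0) (e 1) = ε * α (e 2) (e 3) ∧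
    α (e 0) (e 2) = ε * α (e 3) (e 1) ∧ α (e 0) (e 3) = ε * α (e 1) (e 2)}
  zero_mem' := by simp
  add_mem' := by
    rintro α β ⟨h0, h1, h2, h3⟩ ⟨k0, k1, k2, k3⟩
    refine ⟨fun v => ?_, ?_, ?_, ?_⟩
    · simp [h0, k0]
    · simp only [LinearMap.add_apply, h1, k1]; ring
    · simp only [LinearMap.add_apply, h2, k2]; ring
    · simp only [LinearMap.add_apply, h3, k3]; ring
  smul_mem' := by
    rintro c α ⟨h0, h1, h2, h3⟩
    refine ⟨fun v => ?_, ?_, ?_, ?_⟩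
    · simp [h0]
    · simp only [LinearMap.smul_apply, h1, smul_eq_mul]; ring
    · simp only [LinearMap.smul_apply, h2, smul_eq_mul]; ring
    · simp only [LinearMap.smul_apply, h3, smul_eq_mul]; ring

/-- The 2-form `a ∧ b`, with `(a ∧ b)(v, w) = a(v) b(w) - a(w) b(v)`. -/
def wedgeCovectors (a b : Module.Dual ℝ E4) : Bil :=
  LinearMap.BilinForm.linMulLin a b - LinearMap.BilinForm.linMulLin b a

/-- The frame of `Λ⁺` (`ε = 1`) or `Λ⁻` (`ε = -1`) that belongs to an oriented orthonormal basis
`e`, with dual basis `e⁰, …, e³`. If the `eⁱ ∧ eʲ`, `i < j`, are taken to be orthonormal, then the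
three forms are orthogonal and of the same length. -/
def dualFrame (e : Module.Basis (Fin 4) ℝ E4) (ε : ℝ) : Fin 3 → Bil :=
  ![wedgeCovectors (e.coord 0) (e.coord 1) + ε • wedgeCovectors (e.coord 2) (e.coord 3),
    wedgeCovectors (e.coord 0) (e.coord 2) + ε • wedgeCovectors (e.coord 3) (e.coord 1),
    wedgeCovectors (e.coord 0) (e.coord 3) + ε • wedgeCovectors (e.coord 1) (e.coord 2)]

/-- The value of the 4-form `α ∧ β` on the basis `e`. -/
def wedge (e : Module.Basis (Fin 4) ℝ E4) (α β : Bil) : ℝ :=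
  α (e 0) (e 1) * β (e 2) (e 3) - α (e 0) (e 2) * β (e 1) (e 3) + α (e 0) (e 3) * β (e 1) (e 2)
    + α (e 1) (e 2) * β (e 0) (e 3) - α (e 1) (e 3) * β (e 0) (e 2) + α (e 2) (e 3) * β (e 0) (e 1)

/-- A subspace of 2-forms on which the wedge product `Λ² × Λ² → Λ⁴` is definite, i.e. positive
for one of the two orientations; the basis `e` only serves to name that orientation. -/
def IsDefiniteSubspace (V : Submodule ℝ Bil) : Prop :=
  (∀ α ∈ V, ∀ v, α v v = 0) ∧
    ∃ e : Module.Basis (Fin 4) ℝ E4, ∀ α ∈ V, α ≠ 0 → 0 < wedge e α α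

/-- The matrix, in the basis `e`, of the endomorphism `L` that corresponds to the 2-form `α` under
`Λ² ≅ 𝔰𝔬(4)`, `a ∧ b ↦ (v ↦ b(v) a - a(v) b)`; here `e` is an orthonormal basis, so that
`⟨L v, w⟩ = α(w, v)`. -/
def formMatrix (e : Module.Basis (Fin 4) ℝ E4) (α : Bil) : Matrix (Fin 4) (Fin 4) ℝ :=
  Matrix.of fun i j => α (e i) (e j)

end Forms

/-! ### Definite curvature and its sign

An orthonormal frame of a fibre of an `SO(3)`-bundle `E` identifies `𝔰𝔬(E_x)` with the Lie algebra
`𝔰𝔬(3)` of skew-symmetric matrices. The curvature of a connection in `E` is then, at a point, a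
2-form `F` with values in `𝔰𝔬(3)`. -/

section Definite

attribute [local instance] LieRing.ofAssociativeRing

/-- The Lie algebra `𝔰𝔬(3)` of skew-symmetric `3 × 3` matrices. -/
abbrev so3 : LieSubalgebra ℝ (Matrix (Fin 3) (Fin 3) ℝ) := LieAlgebra.Orthogonal.so (Fin 3) ℝ

/-- The curvature as a map `𝔰𝔬(3)* → Λ²`. -/
def curvatureMap (F : E4 →ₗ[ℝ] E4 →ₗ[ℝ] so3) : Module.Dual ℝ so3 →ₗ[ℝ] Bil where
  toFun φ := F.compr₂ φ
  map_add' _ _ := rfl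
  map_smul' _ _ := rfl

/-- The curvature is definite: the image of the curvature map is a maximal definite subspace for
the wedge product. -/
def IsDefinite (F : E4 →ₗ[ℝ] E4 →ₗ[ℝ] so3) : Prop :=
  Maximal IsDefiniteSubspace (LinearMap.range (curvatureMap F))

/-- The sign of the third coordinate of `⁅b 0, b 1⁆`. A basis `b` of `𝔰𝔬(3)` is positively
oriented when this is `1`: under `ℝ³ ≅ 𝔰𝔬(3)` the bracket is the vector product, and the triple
`(v, w, v × w)` is positively oriented. -/
def basisSign (b : Module.Basis (Fin 3) ℝ so3) : SignType :=
  SignType.sign (b.repr ⁅b 0, b 1⁆ 2)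

/-- The triple `α` of self-dual forms for `e` has orientation `s` in `Λ⁺`, where `Λ⁺` is oriented
as the Lie algebra `𝔰𝔬(3)`, a summand of `𝔰𝔬(4) ≅ Λ²`. -/
def HasFormOrientation (e : Module.Basis (Fin 4) ℝ E4) (α : Fin 3 → Bil) (s : SignType) : Prop :=
  ∃ r : Fin 3 → ℝ, SignType.sign (r 2) = s ∧
    formMatrix e (α 0) * formMatrix e (α 1) - formMatrix e (α 1) * formMatrix e (α 0)
      = ∑ i, r i • formMatrix e (α i)

/-- A definite curvature `F` has sign `s`. A conformal structure and an orientation (given by an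
oriented conformal basis `e`) are determined by requiring that the image of the curvature map
is the space `Λ⁺` of self-dual forms; the curvature map `𝔰𝔬(3)* → Λ⁺` is then orientation
preserving (`s = 1`) or reversing (`s = -1`): it sends the dual basis of a positively oriented
basis of `𝔰𝔬(3)` to a basis of orientation `s`. Neither the choice of `e` nor that of `b`
matters. -/
def HasSign (F : E4 →ₗ[ℝ] E4 →ₗ[ℝ] so3) (s : SignType) : Prop :=
  ∃ e : Module.Basis (Fin 4) ℝ E4, LinearMap.range (curvatureMap F) = dualForms e 1 ∧
    ∃ b : Module.Basis (Fin 3) ℝ so3, basisSign b = 1 ∧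
      HasFormOrientation e (fun i => curvatureMap F (b.coord i)) s

end Definite

/-! ### Oriented Riemannian four-manifolds -/

section Manifold

variable {X : Type*} [TopologicalSpace X] [ChartedSpace E4 X]

/-- The differential at `y` of the inverse of the preferred chart at `x`: it maps coordinate
vectors to tangent vectors of `X`. -/
def chartDifferential (x : X) (y : E4) :
    E4 →L[ℝ] TangentSpace (𝓡 4) ((extChartAt (𝓡 4) x).symm y) :=
  mfderiv 𝓘(ℝ, E4) (𝓡 4) (extChartAt (𝓡 4) x).symm y

variable (X) in
/-- An orientation of `X`: an orientation of each tangent space, locally constant in charts.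
Recall that `TangentSpace (𝓡 4) x` is `ℝ⁴`, identified by means of the preferred chart at `x`. -/
structure ManifoldOrientation where
  /-- The orientation of the tangent space at `x`. -/
  at_point (x : X) : Orientation ℝ (TangentSpace (𝓡 4) x) (Fin 4)
  locally_constant (x : X) : ∀ᶠ y in 𝓝 (extChartAt (𝓡 4) x x),
    ∀ (b : Module.Basis (Fin 4) ℝ (TangentSpace (𝓡 4) x))
      (b' : Module.Basis (Fin 4) ℝ (TangentSpace (𝓡 4) ((extChartAt (𝓡 4) x).symm y))),
      (∀ i, b' i = chartDifferential x y (b i)) →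
        (b'.orientation = at_point ((extChartAt (𝓡 4) x).symm y) ↔ b.orientation = at_point x)

variable [IsManifold (𝓡 4) ∞ X]

variable (X) in
/-- Smooth Riemannian metrics on `X`. -/
abbrev RMetric : Type _ :=
  Bundle.ContMDiffRiemannianMetric (𝓡 4) ∞ E4 (fun x : X => TangentSpace (𝓡 4) x)

/-- The metric `g` in the preferred chart at `x`. -/
def coordMetric (g : RMetric X) (x : X) : CoordMetric :=
  fun y =>
    let gp : E4 →L[ℝ] E4 →L[ℝ] ℝ := g.inner ((extChartAt (𝓡 4) x).symm y)
    let D : E4 →L[ℝ] E4 := chartDifferential x y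
    gp.bilinearComp D D

/-- The sectional curvature of `g` at `x` on the plane spanned by `u` and `v`. Tangent vectors at
`x` are given by their coordinates in the preferred chart at `x`. -/
def sec (g : RMetric X) (x : X) (u v : E4) : ℝ :=
  sectional (coordMetric g x) (extChartAt (𝓡 4) x x) u v

/-- All sectional curvatures are positive. -/
def PositiveCurvature (g : RMetric X) : Prop :=
  ∀ x u v, LinearIndependent ℝ ![u, v] → 0 < sec g x u v

/-- All sectional curvatures are negative. -/
def NegativeCurvature (g : RMetric X) : Prop :=
  ∀ x u v, LinearIndependent ℝ ![u, v] → sec g x u v < 0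

/-- Pointwise `K`-pinching, for sectional curvatures of one sign: at each point, the ratio of the
smallest to the largest absolute value of the sectional curvatures exceeds `K`. Both are attained,
so this says that the ratio of any two sectional curvatures at the point exceeds `K`. -/
def IsPinched (g : RMetric X) (K : ℝ) : Prop :=
  ∀ x u v u' v', LinearIndependent ℝ ![u, v] → LinearIndependent ℝ ![u', v'] →
    K < sec g x u v / sec g x u' v'

/-- `e` is an oriented orthonormal basis of the tangent space at `x`. -/
def IsOrientedOrthonormal (g : RMetric X) (o : ManifoldOrientation X) (x : X)
    (e : Module.Basis (Fin 4) ℝ E4) : Prop :=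
  (∀ i j, coordMetric g x (extChartAt (𝓡 4) x x) (e i) (e j) = if i = j then 1 else 0) ∧
    e.orientation = o.at_point x

/-- `F` is the curvature at `x` of the connection induced by the Levi-Civita connection on
`Λ⁺` (`ε = 1`) or `Λ⁻` (`ε = -1`). It is written as a 2-form with values in `𝔰𝔬(3)` by means of
the frame `s = dualFrame e ε`, where `e` is an oriented orthonormal basis at `x`:
`F(u, v) s_j = ∑ i, F(u, v)_{ij} s_i`. -/
def IsCurvatureOnDual (g : RMetric X) (x : X) (e : Module.Basis (Fin 4) ℝ E4) (ε : ℝ)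
    (F : E4 →ₗ[ℝ] E4 →ₗ[ℝ] so3) : Prop :=
  ∀ (u v : E4) (j : Fin 3) (a b : E4),
    formCurvature (coordMetric g x) (extChartAt (𝓡 4) x x) u v (dualFrame e ε j) a b
      = ∑ i, (F u v : Matrix (Fin 3) (Fin 3) ℝ) i j * dualFrame e ε i a b

/-- The connection induced by the Levi-Civita connection of `g` on `Λ⁺` (`ε = 1`) or `Λ⁻`
(`ε = -1`) is definite, with sign `s`: positive definite for `s = 1`, negative definite for
`s = -1`. -/
def InducesDefinite (g : RMetric X) (o : ManifoldOrientation X) (ε : ℝ) (s : SignType) : Prop :=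
  ∀ (x : X) (e : Module.Basis (Fin 4) ℝ E4), IsOrientedOrthonormal g o x e →
    ∃ F : E4 →ₗ[ℝ] E4 →ₗ[ℝ] so3,
      IsCurvatureOnDual g x e ε F ∧ IsDefinite F ∧ HasSign F s

/-- The induced connections on `Λ⁺` and on `Λ⁻` are both positive definite. -/
def InducesPositiveDefinite (g : RMetric X) (o : ManifoldOrientation X) : Prop :=
  InducesDefinite g o 1 1 ∧ InducesDefinite g o (-1) 1

/-- The induced connections on `Λ⁺` and on `Λ⁻` are both negative definite. -/
def InducesNegativeDefinite (g : RMetric X) (o : ManifoldOrientation X) : Prop :=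
  InducesDefinite g o 1 (-1) ∧ InducesDefinite g o (-1) (-1)

end Manifold

end PinchedConnections

end

noncomputable section

namespace PinchedConnections

/-! Everything happens at one point. On `Λ² = Λ⁺ ⊕ Λ⁻` the curvature operator has symmetric diagonal
blocks `A`, `C` and an off-diagonal block `B`, and the first Bianchi identity says `tr A = tr C`. A
2-form `x + y` with `x` self-dual and `y` anti-self-dual is decomposable when `|x| = |y|`, so up to
a factor the sectional curvatures are the values of `q(x, y) = x·Ax + 2 x·By + y·Cy` at pairs of
unit vectors. Up to sign, the curvature of `Λ⁺` is the space of forms with self-dual part `Ax` and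
anti-self-dual part `Bᵀx`.

The analytic core is `offDiagonal_lt_of_pinched`: pinching gives `x·By < x·Ax` for all unit `x`,
`y`. Complete `x` and `y` to orthonormal bases; compare the values of `q` at `(x', ±y)`, `(x'', ±y)`
with those at `(x, -y)` and at `(x, ±y')`, `(x, ±y'')`. The equality of traces makes the remaining
terms cancel exactly at the constant `2/5`. Consequently `A` is positive definite and `|Bᵀx| < |Ax|`
for `x ≠ 0` (`posDef_of_pinched`), so the wedge product is positive on the image of the curvature.

Definiteness and sign then follow from linear algebra (`exists_selfDual_frame`): a wedge-positive
triple of 2-forms spans the self-dual forms of some basis, and `det A > 0` determines its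
orientation. Negative curvature is the same argument for `-R`; `Λ⁻` is `Λ⁺` for the reversed
orientation.

For optimality, take a metric near the origin of `ℝ⁴` whose curvature there has, up to sign, `A =
diag(0, 3, 3)`, `B = 0`, `C = 2`. With sectional curvature `q/2` the extremes are `1` and `5/2`, the
borderline ratio, while the curvature of `Λ⁺` has a kernel. Continuity and compactness give
`K`-pinching on a small ball for every `K < 2/5`. -/

/-- `G` is a smooth Riemannian metric in a neighbourhood of `y`. -/
structure RegularMetricAt (G : CoordMetric) (y : E4) : Prop where
  contDiffAt : ContDiffAt ℝ ∞ G y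
  symm : ∀ᶠ z in 𝓝 y, ∀ v w, G z v w = G z w v
  pos : ∀ v, v ≠ 0 → 0 < G y v v

/-- In finite dimensions an operator-valued map is a combination of its values on a basis, so
smoothness can be tested on scalars, where the bundle calculus applies. -/
theorem contDiffAt_of_apply₂ {G : CoordMetric} {y : E4}
    (h : ∀ v w, ContDiffAt ℝ ∞ (fun z => G z v w) y) : ContDiffAt ℝ ∞ G y := by
  have key : ∀ {F : Type} [NormedAddCommGroup F] [NormedSpace ℝ F] (f : E4 → E4 →L[ℝ] F),
      (∀ v, ContDiffAt ℝ ∞ (fun z => f z v) y) → ContDiffAt ℝ ∞ f y := by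
    intro F _ _ f hf
    let b := (EuclideanSpace.basisFun (Fin 4) ℝ).toBasis
    have hsum : f = fun z => ∑ i, (LinearMap.toContinuousLinearMap (b.coord i)).smulRight
        (f z (b i)) := by
      funext z
      ext v
      simp only [sum_apply, ContinuousLinearMap.smulRight_apply,
        LinearMap.coe_toContinuousLinearMap', Module.Basis.coord_apply]
      conv_lhs => rw [← b.sum_repr v, map_sum]
      simp only [map_smul]
    rw [hsum]
    refine ContDiffAt.sum fun i _ => ?_
    exact ((ContinuousLinearMap.smulRightL ℝ E4 F
      (LinearMap.toContinuousLinearMap (b.coord i))).contDiff.contDiffAt).comp y (hf (b i))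
  exact key G fun v => key _ fun w => h v w

/-! ### The metric of a manifold in a preferred chart. -/

section Manifold

variable {X : Type*} [TopologicalSpace X] [ChartedSpace E4 X] [IsManifold (𝓡 4) ∞ X]

/-- The link to the tangent bundle: smoothness and injectivity of the chart differential are
inherited from the trivialization. -/
theorem chartDifferential_eq_symmL {x : X} {y : E4} (hy : y ∈ (extChartAt (𝓡 4) x).target) :
    chartDifferential x y = (trivializationAt E4 (TangentSpace (𝓡 4)) x).symmL ℝ
      ((extChartAt (𝓡 4) x).symm y) := by
  have hx : (extChartAt (𝓡 4) x).symm y ∈ (chartAt E4 x).source := by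
    rw [← extChartAt_source (𝓡 4)]
    exact (extChartAt (𝓡 4) x).map_target hy
  rw [TangentBundle.symmL_trivializationAt hx, (extChartAt (𝓡 4) x).right_inv hy]
  rw [chartDifferential, ← mfderivWithin_univ]
  simp only [modelWithCornersSelf_coe, Set.range_id]
  rfl

theorem contMDiffAt_chartDifferential (x : X) (v : E4) :
    ContMDiffAt 𝓘(ℝ, E4) ((𝓡 4).prod 𝓘(ℝ, E4)) ∞
      (fun y => Bundle.TotalSpace.mk' E4 (E := TangentSpace (𝓡 4))
        ((extChartAt (𝓡 4) x).symm y) (chartDifferential x y v)) (extChartAt (𝓡 4) x x) := by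
  rw [Bundle.contMDiffAt_totalSpace]
  have hnhds : (extChartAt (𝓡 4) x).target ∈ 𝓝 (extChartAt (𝓡 4) x x) :=
    extChartAt_target_mem_nhds x
  refine ⟨(contMDiffOn_extChartAt_symm x).contMDiffAt hnhds, ?_⟩
  refine (contMDiffAt_const (c := v)).congr_of_eventuallyEq ?_
  filter_upwards [hnhds] with y hy
  have hx : (extChartAt (𝓡 4) x).symm y ∈ (chartAt E4 x).source := by
    rw [← extChartAt_source (𝓡 4)]
    exact (extChartAt (𝓡 4) x).map_target hy
  rw [chartDifferential_eq_symmL hy]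
  simp only [extChartAt_to_inv]
  have := Bundle.Trivialization.apply_mk_symm
    (trivializationAt E4 (TangentSpace (𝓡 4)) x) (b := (extChartAt (𝓡 4) x).symm y) hx v
  rw [Bundle.Trivialization.symmL_apply _ hx]
  exact congrArg Prod.snd this

theorem regularMetricAt_coordMetric (g : RMetric X) (x : X) :
    RegularMetricAt (coordMetric g x) (extChartAt (𝓡 4) x x) where
  contDiffAt := by
    refine contDiffAt_of_apply₂ fun v w => ?_
    have hnhds : (extChartAt (𝓡 4) x).target ∈ 𝓝 (extChartAt (𝓡 4) x x) :=
      extChartAt_target_mem_nhds x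
    have hb : ContMDiffAt 𝓘(ℝ, E4) (𝓡 4) ∞ (extChartAt (𝓡 4) x).symm (extChartAt (𝓡 4) x x) :=
      (contMDiffOn_extChartAt_symm x).contMDiffAt hnhds
    have hg : ContMDiffAt 𝓘(ℝ, E4) ((𝓡 4).prod 𝓘(ℝ, E4 →L[ℝ] E4 →L[ℝ] ℝ)) ∞
        (fun y => Bundle.TotalSpace.mk' (E4 →L[ℝ] E4 →L[ℝ] ℝ)
          (E := fun p : X => TangentSpace (𝓡 4) p →L[ℝ] TangentSpace (𝓡 4) p →L[ℝ] ℝ)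
          ((extChartAt (𝓡 4) x).symm y) (g.inner ((extChartAt (𝓡 4) x).symm y)))
        (extChartAt (𝓡 4) x x) :=
      ContMDiffAt.comp (I' := 𝓡 4) (extChartAt (𝓡 4) x x) g.contMDiff.contMDiffAt hb
    have h : ContMDiffAt 𝓘(ℝ, E4) ((𝓡 4).prod 𝓘(ℝ)) ∞
        (fun y => Bundle.TotalSpace.mk' ℝ (E := Bundle.Trivial X ℝ)
          ((extChartAt (𝓡 4) x).symm y) (g.inner ((extChartAt (𝓡 4) x).symm y)
            (chartDifferential x y v) (chartDifferential x y w))) (extChartAt (𝓡 4) x x) := by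
      apply ContMDiffAt.clm_bundle_apply₂ (F₁ := E4) (F₂ := E4)
      · exact hg
      · exact contMDiffAt_chartDifferential x v
      · exact contMDiffAt_chartDifferential x w
    rw [Bundle.contMDiffAt_totalSpace] at h
    exact h.2.contDiffAt
  symm := Filter.Eventually.of_forall fun z v w => g.symm _ _ _
  pos v hv := by
    have h := g.pos ((extChartAt (𝓡 4) x).symm (extChartAt (𝓡 4) x x))
      (chartDifferential x (extChartAt (𝓡 4) x x) v)
    refine h fun h0 => hv ?_
    have hx : (extChartAt (𝓡 4) x).symm (extChartAt (𝓡 4) x x) ∈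
        (trivializationAt E4 (TangentSpace (𝓡 4)) x).baseSet := by
      rw [extChartAt_to_inv]; exact mem_chart_source E4 x
    rw [chartDifferential_eq_symmL (mem_extChartAt_target x)] at h0
    have h1 := (trivializationAt E4 (TangentSpace (𝓡 4)) x).continuousLinearMapAt_symmL
      (R := ℝ) hx v
    rw [← h1, h0, map_zero]

end Manifold

/-! ### Levi-Civita curvature in coordinates and its symmetries. -/

section Curvature

set_option maxSynthPendingDepth 4

open ContinuousLinearMap

/-- `christoffelLower` as a continuous trilinear form. -/
def christoffelForm (G : CoordMetric) (y : E4) : E4 →L[ℝ] E4 →L[ℝ] E4 →L[ℝ] ℝ :=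
  (1 / 2 : ℝ) • (fderiv ℝ G y + (fderiv ℝ G y).flip
    - ((flipₗᵢ ℝ E4 E4 ℝ).toContinuousLinearEquiv : (E4 →L[ℝ] E4 →L[ℝ] ℝ) →L[ℝ] _).comp
      (fderiv ℝ G y).flip)

theorem christoffelForm_apply (G : CoordMetric) (y u v : E4) :
    christoffelForm G y u v = christoffelLower G y u v := by
  ext w
  simp [christoffelForm, christoffelLower]

/-- The Christoffel symbols as a continuous bilinear map. -/
def christoffelMap (G : CoordMetric) (y : E4) : E4 →L[ℝ] E4 →L[ℝ] E4 :=
  (compL ℝ E4 (E4 →L[ℝ] ℝ) E4 (G y).inverse).comp (christoffelForm G y)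

theorem christoffelMap_apply (G : CoordMetric) (y u v : E4) :
    christoffelMap G y u v = christoffel G y u v := by
  simp [christoffelMap, christoffel, christoffelForm_apply]

/-- The map `(u, v, w) ↦ ∂_u Γ(v, w) + Γ(u, Γ(v, w))`. -/
def secondNabla (G : CoordMetric) (y : E4) : E4 →L[ℝ] E4 →L[ℝ] E4 →L[ℝ] E4 :=
  fderiv ℝ (christoffelMap G) y + ((compL ℝ E4 (E4 →L[ℝ] E4) (E4 →L[ℝ] E4)).flip
    (christoffelMap G y)).comp ((compL ℝ E4 E4 E4).comp (christoffelMap G y))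

/-- The Riemann curvature as a continuous trilinear map. -/
def riemannMap (G : CoordMetric) (y : E4) : E4 →L[ℝ] E4 →L[ℝ] E4 →L[ℝ] E4 :=
  secondNabla G y - (secondNabla G y).flip

theorem secondNabla_apply (G : CoordMetric) (y u v w : E4) :
    secondNabla G y u v w = fderiv ℝ (christoffelMap G) y u v w
      + christoffelMap G y u (christoffelMap G y v w) := by
  simp [secondNabla]

theorem riemannMap_apply (G : CoordMetric) (y u v w : E4) :
    riemannMap G y u v w = secondNabla G y u v w - secondNabla G y v u w := by
  simp [riemannMap]

namespace RegularMetricAt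

variable {G : CoordMetric} {y : E4}

theorem isInvertible (h : RegularMetricAt G y) : (G y).IsInvertible := by
  have hinj : Function.Injective (G y : E4 →ₗ[ℝ] E4 →L[ℝ] ℝ) := by
    rw [← LinearMap.ker_eq_bot, LinearMap.ker_eq_bot']
    intro v hv
    by_contra h0
    have := h.pos v h0
    have hv' : G y v = 0 := hv
    simp [hv'] at this
  have hrank : Module.finrank ℝ E4 = Module.finrank ℝ (E4 →L[ℝ] ℝ) := by
    rw [← (LinearMap.toContinuousLinearMap (𝕜 := ℝ) (E := E4) (F' := ℝ)).finrank_eq]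
    exact (Subspace.dual_finrank_eq).symm
  refine ⟨(LinearEquiv.ofInjectiveOfFinrankEq _ hinj hrank).toContinuousLinearEquiv, ?_⟩
  ext v w
  rfl

theorem eventually_isInvertible (h : RegularMetricAt G y) :
    ∀ᶠ z in 𝓝 y, (G z).IsInvertible := by
  obtain ⟨e, he⟩ := h.isInvertible
  have := h.contDiffAt.continuousAt.eventually (he ▸ ContinuousLinearEquiv.nhds e)
  filter_upwards [this] with z hz
  exact hz

theorem contDiffAt_fderiv (h : RegularMetricAt G y) : ContDiffAt ℝ ∞ (fderiv ℝ G) y :=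
  h.contDiffAt.fderiv_right (by simp)

theorem contDiffAt_christoffelMap (h : RegularMetricAt G y) :
    ContDiffAt ℝ ∞ (christoffelMap G) y := by
  have hD := h.contDiffAt_fderiv
  have hinv : ContDiffAt ℝ ∞ (fun z => (G z).inverse) y := by
    obtain ⟨e, he⟩ := h.isInvertible
    exact ContDiffAt.comp y (he ▸ contDiffAt_map_inverse e) h.contDiffAt
  have hflip : ContDiffAt ℝ ∞ (fun z => (fderiv ℝ G z).flip) y :=
    (flipₗᵢ ℝ E4 E4 (E4 →L[ℝ] ℝ)).contDiff.contDiffAt.comp y hD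
  have hform : ContDiffAt ℝ ∞ (christoffelForm G) y :=
    ((hD.add hflip).sub (contDiffAt_const.clm_comp hflip)).const_smul _
  exact ((compL ℝ E4 (E4 →L[ℝ] ℝ) E4).contDiff.contDiffAt.comp y hinv).clm_comp hform

theorem eventually_differentiableAt (h : RegularMetricAt G y) :
    ∀ᶠ z in 𝓝 y, DifferentiableAt ℝ G z := by
  have h1 : ContDiffAt ℝ 1 G y := h.contDiffAt.of_le (by norm_cast)
  filter_upwards [h1.eventually (by simp)] with z hz
  exact hz.differentiableAt (by simp)

theorem eventually_fderiv_symm (h : RegularMetricAt G y) :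
    ∀ᶠ z in 𝓝 y, ∀ u v w, fderiv ℝ G z u v w = fderiv ℝ G z u w v := by
  filter_upwards [h.eventually_differentiableAt, h.symm.eventually_nhds] with z hz hs u v w
  have key : ∀ v w, fderiv ℝ (fun x => G x v w) z = ((fderiv ℝ G z).flip v).flip w := by
    intro v w
    have := (hz.hasFDerivAt.clm_apply (hasFDerivAt_const v z)).clm_apply (hasFDerivAt_const w z)
    rw [this.fderiv]
    ext u
    simp
  have h1 : fderiv ℝ (fun x => G x v w) z = fderiv ℝ (fun x => G x w v) z :=
    Filter.EventuallyEq.fderiv_eq (hs.mono fun x hx => hx v w)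
  rw [key, key] at h1
  simpa using congrArg (fun L => L u) h1

theorem eventually_christoffel_spec (h : RegularMetricAt G y) :
    ∀ᶠ z in 𝓝 y, ∀ u v, G z (christoffelMap G z u v) = christoffelLower G z u v := by
  filter_upwards [h.eventually_isInvertible] with z hz u v
  obtain ⟨e, he⟩ := hz
  rw [christoffelMap_apply, christoffel, ← he, inverse_equiv]
  simp

theorem eventually_christoffel_symm (h : RegularMetricAt G y) :
    ∀ᶠ z in 𝓝 y, ∀ u v, christoffelMap G z u v = christoffelMap G z v u := by
  filter_upwards [h.eventually_fderiv_symm] with z hz u v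
  rw [christoffelMap_apply, christoffelMap_apply, christoffel, christoffel]
  congr 1
  ext w
  simp only [christoffelLower, smul_apply, sub_apply, add_apply, flip_apply, hz w u v]
  ring

/-- Metric compatibility `∇g = 0`: in the sum of the two Koszul expressions all but one derivative
of `G` cancel. -/
theorem eventually_fderiv_eq (h : RegularMetricAt G y) :
    ∀ᶠ z in 𝓝 y, ∀ u v w, fderiv ℝ G z u v w
      = G z (christoffelMap G z u v) w + G z v (christoffelMap G z u w) := by
  filter_upwards [h.eventually_fderiv_symm, h.eventually_christoffel_spec, h.symm]
    with z hD hs hG u v w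
  rw [hG v, hs, hs]
  simp only [christoffelLower, smul_apply, sub_apply, add_apply, flip_apply, hD u w v, hD w u v,
    hD v u w, smul_eq_mul]
  ring

theorem differentiableAt_christoffelMap (h : RegularMetricAt G y) :
    DifferentiableAt ℝ (christoffelMap G) y :=
  h.contDiffAt_christoffelMap.differentiableAt (by simp)

theorem hasFDerivAt_christoffelMap (h : RegularMetricAt G y) (v w : E4) :
    HasFDerivAt (fun z => christoffelMap G z v w)
      (((fderiv ℝ (christoffelMap G) y).flip v).flip w) y := by
  have := (h.differentiableAt_christoffelMap.hasFDerivAt.clm_apply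
    (hasFDerivAt_const v y)).clm_apply (hasFDerivAt_const w y)
  refine this.congr_fderiv ?_
  ext u
  simp

theorem riemann_eq (h : RegularMetricAt G y) (u v w : E4) :
    riemann G y u v w = riemannMap G y u v w := by
  have key : ∀ u v, nablaVec G u (nablaVec G v fun _ => w) y = secondNabla G y u v w := by
    intro u v
    have h1 : (nablaVec G v fun _ => w) = fun z => christoffelMap G z v w := by
      funext z
      simp [nablaVec, christoffelMap_apply]
    rw [h1, nablaVec, (h.hasFDerivAt_christoffelMap v w).fderiv, secondNabla_apply,
      ← christoffelMap_apply]
    simp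
  rw [riemann, key, key, riemannMap_apply]

theorem riemannMap_swap (G : CoordMetric) (y u v w : E4) :
    riemannMap G y v u w = - riemannMap G y u v w := by
  simp [riemannMap_apply]

/-- Absence of torsion: `Γ` is symmetric near `y`, hence so is its derivative at `y`, and the six
terms cancel cyclically. -/
theorem bianchi (h : RegularMetricAt G y) (u v w : E4) :
    riemannMap G y u v w + riemannMap G y v w u + riemannMap G y w u v = 0 := by
  have hs := h.eventually_christoffel_symm
  have hd : ∀ u v w, fderiv ℝ (christoffelMap G) y u v w
      = fderiv ℝ (christoffelMap G) y u w v := by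
    intro u v w
    have h1 := (h.hasFDerivAt_christoffelMap v w).fderiv
    rw [Filter.EventuallyEq.fderiv_eq (hs.mono fun z hz => hz v w),
      (h.hasFDerivAt_christoffelMap w v).fderiv] at h1
    simpa using (congrArg (fun L => L u) h1).symm
  have h0 := hs.self_of_nhds
  simp only [riemannMap_apply, secondNabla_apply]
  rw [hd u v w, hd v w u, hd w u v, h0 v w, h0 w u, h0 u v]
  abel

/-- Differentiating `g(w, w)` twice gives `2 g(∇_u ∇_v w, w) + 2 g(∇_u w, ∇_v w)`. The left side is
symmetric in `u`, `v` by Schwarz and the last term visibly so; hence the first is symmetric too. -/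
theorem inner_riemannMap_self (h : RegularMetricAt G y) (u v w : E4) :
    G y (riemannMap G y u v w) w = 0 := by
  have hev : ∀ v, (fun z => fderiv ℝ G z v w w) =ᶠ[𝓝 y]
      fun z => 2 * G z (christoffelMap G z v w) w := by
    intro v
    filter_upwards [h.eventually_fderiv_eq, h.symm] with z hz hs
    rw [hz, hs w]
    ring
  have hG : HasFDerivAt G (fderiv ℝ G y) y :=
    (h.contDiffAt.differentiableAt (by simp)).hasFDerivAt
  have hDG : HasFDerivAt (fderiv ℝ G) (fderiv ℝ (fderiv ℝ G) y) y :=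
    (h.contDiffAt_fderiv.differentiableAt (by simp)).hasFDerivAt
  have key : ∀ u v, fderiv ℝ (fderiv ℝ G) y u v w w = 2 * (G y (secondNabla G y u v w) w
      + G y (christoffelMap G y u w) (christoffelMap G y v w)) := by
    intro u v
    have h1 := ((hDG.clm_apply (hasFDerivAt_const v y)).clm_apply
      (hasFDerivAt_const w y)).clm_apply (hasFDerivAt_const w y)
    have h2 := ((hG.clm_apply (h.hasFDerivAt_christoffelMap v w)).clm_apply
      (hasFDerivAt_const w y)).const_mul 2
    have h3 := (h1.congr_of_eventuallyEq (hev v).symm).unique h2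
    have h4 := congrArg (fun L => L u) h3
    simp only [add_apply, flip_apply, comp_apply, zero_apply, map_zero, smul_apply, smul_eq_mul,
      zero_add] at h4
    rw [h4, secondNabla_apply, h.eventually_fderiv_eq.self_of_nhds,
      h.symm.self_of_nhds (christoffelMap G y v w)]
    simp only [map_add, add_apply]
    ring
  have hsymm : IsSymmSndFDerivAt ℝ G y := h.contDiffAt.isSymmSndFDerivAt (by simp; norm_cast)
  have h5 := key u v
  rw [hsymm.eq u v, key v u, h.symm.self_of_nhds (christoffelMap G y v w)] at h5
  rw [riemannMap_apply, map_sub, sub_apply]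
  linarith

theorem inner_riemannMap_swap (h : RegularMetricAt G y) (u v w z : E4) :
    G y (riemannMap G y u v w) z = - G y (riemannMap G y u v z) w := by
  have h1 := h.inner_riemannMap_self u v (w + z)
  simp only [map_add, add_apply, h.inner_riemannMap_self] at h1
  linarith

/-- Curvature acts on tensors as a derivation: the mixed terms `α(Γ_u a, Γ_v b) + α(Γ_v a, Γ_u b)`
are symmetric in `u`, `v` and disappear on antisymmetrizing. -/
theorem formCurvature_eq (h : RegularMetricAt G y) (u v : E4) (α : Bil) (a b : E4) :
    formCurvature G y u v α a b
      = - α (riemannMap G y u v a) b - α a (riemannMap G y u v b) := by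
  have hα : ∀ v a b, HasFDerivAt (fun z => α (christoffelMap G z v a) b)
      ((LinearMap.toContinuousLinearMap (α.flip b)).comp
        (((fderiv ℝ (christoffelMap G) y).flip v).flip a)) y := fun v a b =>
    (LinearMap.toContinuousLinearMap (α.flip b)).hasFDerivAt.comp y
      (h.hasFDerivAt_christoffelMap v a)
  have hα' : ∀ v a b, HasFDerivAt (fun z => α a (christoffelMap G z v b))
      ((LinearMap.toContinuousLinearMap (α a)).comp
        (((fderiv ℝ (christoffelMap G) y).flip v).flip b)) y := fun v a b =>
    (LinearMap.toContinuousLinearMap (α a)).hasFDerivAt.comp y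
      (h.hasFDerivAt_christoffelMap v b)
  have key : ∀ u v, nablaForm G u (nablaForm G v fun _ a b => α a b) y a b
      = - α (fderiv ℝ (christoffelMap G) y u v a) b - α a (fderiv ℝ (christoffelMap G) y u v b)
        + α (christoffelMap G y v (christoffelMap G y u a)) b
        + α (christoffelMap G y u a) (christoffelMap G y v b)
        + α (christoffelMap G y v a) (christoffelMap G y u b)
        + α a (christoffelMap G y v (christoffelMap G y u b)) := by
    intro u v
    have h1 : (nablaForm G v fun _ a b => α a b) = fun z a b =>
        - α (christoffelMap G z v a) b - α a (christoffelMap G z v b) := by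
      funext z a b
      simp [nablaForm, christoffelMap_apply]
    rw [h1, nablaForm, ((hα v a b).fun_neg.fun_sub (hα' v a b)).fderiv]
    simp only [← christoffelMap_apply, sub_apply, neg_apply, comp_apply, flip_apply,
      LinearMap.coe_toContinuousLinearMap', LinearMap.BilinForm.flip_apply]
    ring
  simp only [formCurvature, Pi.sub_apply, key, riemannMap_apply, secondNabla_apply, map_add,
    map_sub, LinearMap.add_apply, LinearMap.sub_apply]
  ring

theorem continuousAt_riemannMap (h : RegularMetricAt G y) : ContinuousAt (riemannMap G) y := by
  have hΓ := h.contDiffAt_christoffelMap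
  have hdΓ : ContDiffAt ℝ ∞ (fderiv ℝ (christoffelMap G)) y := hΓ.fderiv_right (by simp)
  have hS : ContDiffAt ℝ ∞ (secondNabla G) y :=
    hdΓ.add ((((compL ℝ E4 (E4 →L[ℝ] E4) (E4 →L[ℝ] E4)).flip).contDiff.contDiffAt.comp y
      hΓ).clm_comp (contDiffAt_const.clm_comp hΓ))
  exact (hS.sub ((flipₗᵢ ℝ E4 E4 (E4 →L[ℝ] E4)).contDiff.contDiffAt.comp y hS)).continuousAt

end RegularMetricAt

end Curvature

/-! ### The inequality between the blocks of a pinched curvature operator. -/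

section Pinching

open Matrix

/-- Only the trace formula is needed later: it lets the values on the complement of `x` be summed
without naming the complement. -/
theorem exists_orthonormal_completion {x : Fin 3 → ℝ} (hx : x ⬝ᵥ x = 1) :
    ∃ y z : Fin 3 → ℝ, y ⬝ᵥ y = 1 ∧ z ⬝ᵥ z = 1 ∧
      ∀ M : Matrix (Fin 3) (Fin 3) ℝ, x ⬝ᵥ M *ᵥ x + y ⬝ᵥ M *ᵥ y + z ⬝ᵥ M *ᵥ z = M.trace := by
  have hn : ‖(WithLp.toLp 2 x : EuclideanSpace ℝ (Fin 3))‖ = 1 := by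
    rw [← sq_eq_sq₀ (norm_nonneg _) zero_le_one, ← real_inner_self_eq_norm_sq]
    rw [one_pow, ← hx, PiLp.inner_apply]
    rfl
  obtain ⟨b, hb⟩ := Orthonormal.exists_orthonormalBasis_extension_of_card_eq (𝕜 := ℝ)
    (E := EuclideanSpace ℝ (Fin 3)) (ι := Fin 3) (by simp)
    (v := fun _ => WithLp.toLp 2 x) (s := {0}) (by
      rw [orthonormal_iff_ite]
      rintro ⟨i, hi⟩ ⟨j, hj⟩
      rw [Set.mem_singleton_iff] at hi hj
      subst hi hj
      simp [hn])
  have hb0 : b 0 = WithLp.toLp 2 x := hb 0 rfl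
  let P : Matrix (Fin 3) (Fin 3) ℝ := Matrix.of fun i j => b i j
  have hP : P * Pᵀ = 1 := by
    ext i j
    have := orthonormal_iff_ite.1 b.orthonormal j i
    simp only [PiLp.inner_apply, RCLike.inner_apply, conj_trivial] at this
    simp only [Matrix.mul_apply, Matrix.transpose_apply, P, Matrix.of_apply, this,
      Matrix.one_apply, eq_comm]
  have hdot : ∀ i, (P i) ⬝ᵥ (P i) = 1 := fun i => by
    have := congrFun (congrFun hP i) i
    simpa [Matrix.mul_apply, dotProduct] using this
  have hx0 : P 0 = x := by
    ext j
    simp [P, hb0]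
  refine ⟨P 1, P 2, hdot 1, hdot 2, fun M => ?_⟩
  have htr : (P * M * Pᵀ).trace = M.trace := by
    rw [Matrix.trace_mul_comm, ← Matrix.mul_assoc, mul_eq_one_comm.1 hP, Matrix.one_mul]
  rw [← htr, Matrix.trace, Fin.sum_univ_three, ← hx0]
  have hd : ∀ i, (P * M * Pᵀ).diag i = P i ⬝ᵥ M *ᵥ P i := by
    intro i
    rw [Matrix.diag_apply, Matrix.mul_assoc, Matrix.mul_apply, dotProduct]
    rfl
  rw [hd, hd, hd]

/-- The value on `x + y`, where `x` is a self-dual and `y` an anti-self-dual form, of a quadratic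
form on 2-forms with the blocks `A`, `B`, `C`. -/
def blockForm (A B C : Matrix (Fin 3) (Fin 3) ℝ) (x y : Fin 3 → ℝ) : ℝ :=
  x ⬝ᵥ A *ᵥ x + 2 * (x ⬝ᵥ B *ᵥ y) + y ⬝ᵥ C *ᵥ y

variable {A B C : Matrix (Fin 3) (Fin 3) ℝ}

theorem blockForm_neg_right (x y : Fin 3 → ℝ) :
    blockForm A B C x (-y) = x ⬝ᵥ A *ᵥ x - 2 * (x ⬝ᵥ B *ᵥ y) + y ⬝ᵥ C *ᵥ y := by
  simp only [blockForm, mulVec_neg, dotProduct_neg, neg_dotProduct]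
  ring

/-- The signs `±y` remove `B` from the averages, and the traces replace the sums over the
complementary vectors, so that only `x·Ax`, `x·By`, `y·Cy` and the common trace remain. -/
theorem offDiagonal_lt_of_pinched (htr : A.trace = C.trace)
    (hq : ∀ x y x' y', x ⬝ᵥ x = 1 → y ⬝ᵥ y = 1 → x' ⬝ᵥ x' = 1 → y' ⬝ᵥ y' = 1 →
      2 * blockForm A B C x' y' < 5 * blockForm A B C x y)
    {x y : Fin 3 → ℝ} (hx : x ⬝ᵥ x = 1) (hy : y ⬝ᵥ y = 1) :
    x ⬝ᵥ B *ᵥ y < x ⬝ᵥ A *ᵥ x := by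
  obtain ⟨x', x'', hx', hx'', hA⟩ := exists_orthonormal_completion hx
  obtain ⟨y', y'', hy', hy'', hC⟩ := exists_orthonormal_completion hy
  have hneg : ∀ {z : Fin 3 → ℝ}, z ⬝ᵥ z = 1 → (-z) ⬝ᵥ (-z) = 1 := by
    intro z hz
    rwa [neg_dotProduct, dotProduct_neg, neg_neg]
  have key : ∀ {a b : Fin 3 → ℝ}, a ⬝ᵥ a = 1 → b ⬝ᵥ b = 1 →
      blockForm A B C x' y + blockForm A B C x' (-y) + blockForm A B C x'' y
        + blockForm A B C x'' (-y) < 10 * blockForm A B C a b := by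
    intro a b ha hb
    have h1 := hq a b x' y ha hb hx' hy
    have h2 := hq a b x' (-y) ha hb hx' (hneg hy)
    have h3 := hq a b x'' y ha hb hx'' hy
    have h4 := hq a b x'' (-y) ha hb hx'' (hneg hy)
    linarith
  -- Write `a = x·Ax`, `b = x·By`, `c = y·Cy` and `T` for the common trace. Then `k0` reads `20b <
  -- 12a + 6c - 2T`, and the sum of `k1`, …, `k4` reads `6c < 8a + 2T`. Together they give `b < a`.
  have k0 := key hx (hneg hy)
  have k1 := key hx hy'
  have k2 := key hx (hneg hy')
  have k3 := key hx hy''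
  have k4 := key hx (hneg hy'')
  have tA := hA A
  have tC := hC C
  simp only [blockForm_neg_right] at k0 k1 k2 k3 k4
  simp only [blockForm] at k0 k1 k2 k3 k4
  linarith

/-- The two conclusions play different roles: the second makes the wedge product positive on the
image of the curvature, the first fixes the orientation. -/
theorem posDef_of_pinched (hA : A.IsSymm) (htr : A.trace = C.trace)
    (hq : ∀ x y x' y', x ⬝ᵥ x = 1 → y ⬝ᵥ y = 1 → x' ⬝ᵥ x' = 1 → y' ⬝ᵥ y' = 1 →
      2 * blockForm A B C x' y' < 5 * blockForm A B C x y) :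
    0 < A.det ∧ ∀ x : Fin 3 → ℝ, x ≠ 0 → (x ᵥ* B) ⬝ᵥ (x ᵥ* B) < (A *ᵥ x) ⬝ᵥ (A *ᵥ x) := by
  have hlt := fun {x y} => offDiagonal_lt_of_pinched (x := x) (y := y) htr hq
  have hpos : ∀ x : Fin 3 → ℝ, x ≠ 0 → 0 < x ⬝ᵥ x := fun x hx => by
    refine lt_of_le_of_ne ?_ fun h => hx (dotProduct_self_eq_zero.1 h.symm)
    exact Finset.sum_nonneg fun i _ => mul_self_nonneg _
  have hunit : ∀ x : Fin 3 → ℝ, x ≠ 0 → ∃ r : ℝ, 0 < r ∧ r ^ 2 = x ⬝ᵥ x ∧ (r⁻¹ • x) ⬝ᵥ (r⁻¹ • x) = 1 := by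
    intro x hx
    have h := hpos x hx
    refine ⟨√(x ⬝ᵥ x), Real.sqrt_pos.2 h, Real.sq_sqrt h.le, ?_⟩
    rw [smul_dotProduct, dotProduct_smul, smul_eq_mul, smul_eq_mul]
    have : (√(x ⬝ᵥ x)) ^ 2 = x ⬝ᵥ x := Real.sq_sqrt h.le
    have h0 : √(x ⬝ᵥ x) ≠ 0 := (Real.sqrt_pos.2 h).ne'
    field_simp
    exact this.symm
  have hform : ∀ {x y : Fin 3 → ℝ}, x ⬝ᵥ x = 1 → y ⬝ᵥ y = 1 → |x ⬝ᵥ B *ᵥ y| < x ⬝ᵥ A *ᵥ x := by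
    intro x y hx hy
    have h1 := hlt hx hy
    have h2 := hlt hx (y := -y) (by rwa [neg_dotProduct, dotProduct_neg, neg_neg])
    rw [mulVec_neg, dotProduct_neg] at h2
    exact abs_lt.2 ⟨by linarith, h1⟩
  constructor
  · refine PosDef.det_pos (PosDef.of_dotProduct_mulVec_pos ?_ fun x hx => ?_)
    · rw [IsHermitian, conjTranspose_eq_transpose_of_trivial]
      exact hA
    · obtain ⟨r, hr, -, h1⟩ := hunit x hx
      have h := (abs_nonneg _).trans_lt (hform h1 h1)
      rw [mulVec_smul, smul_dotProduct, dotProduct_smul, smul_eq_mul, smul_eq_mul,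
        ← mul_assoc] at h
      rw [star_trivial]
      exact (pos_iff_pos_of_mul_pos h).1 (by positivity)
  · intro x hx
    obtain ⟨r, hr, hr2, h1⟩ := hunit x hx
    have hA1 : ∀ y : Fin 3 → ℝ, y ⬝ᵥ y = 1 → |x ⬝ᵥ B *ᵥ y| < r⁻¹ * (x ⬝ᵥ A *ᵥ x) := by
      intro y hy
      have h := hform h1 hy
      rw [mulVec_smul, smul_dotProduct, smul_dotProduct, dotProduct_smul, smul_eq_mul,
        smul_eq_mul, smul_eq_mul, abs_mul, abs_of_pos (inv_pos.2 hr)] at h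
      exact lt_of_mul_lt_mul_left h (inv_pos.2 hr).le
    -- By Cauchy–Schwarz, `x·Ax / |x| ≤ |Ax|`; so it suffices to bound `|Bᵀx|` by the left side.
    have hcs : (x ⬝ᵥ A *ᵥ x) ^ 2 ≤ (x ⬝ᵥ x) * ((A *ᵥ x) ⬝ᵥ (A *ᵥ x)) := by
      simp only [dotProduct, ← pow_two]
      exact Finset.sum_mul_sq_le_sq_mul_sq _ _ _
    have hAx : 0 < x ⬝ᵥ A *ᵥ x := by
      have := (abs_nonneg _).trans_lt (hA1 _ h1)
      exact (pos_iff_pos_of_mul_pos this).1 (inv_pos.2 hr)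
    have hAA : (r⁻¹ * (x ⬝ᵥ A *ᵥ x)) ^ 2 ≤ (A *ᵥ x) ⬝ᵥ (A *ᵥ x) := by
      rw [mul_pow, inv_pow, hr2, inv_mul_le_iff₀ (hpos x hx)]
      exact hcs
    -- If `Bᵀx ≠ 0`, the unit vector `y = Bᵀx / |Bᵀx|` realizes `x·By = |Bᵀx|`.
    by_cases hB : x ᵥ* B = 0
    · rw [hB, zero_dotProduct]
      refine lt_of_lt_of_le ?_ hAA
      positivity
    · obtain ⟨s, hs, hs2, hy⟩ := hunit _ hB
      have h := hA1 _ hy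
      rw [mulVec_smul, dotProduct_smul, dotProduct_mulVec, ← hs2, smul_eq_mul, pow_two,
        ← mul_assoc, inv_mul_cancel₀ hs.ne', one_mul, abs_of_pos hs] at h
      rw [← hs2]
      refine lt_of_lt_of_le ?_ hAA
      gcongr

end Pinching

/-! ### Normal form of a wedge-orthonormal triple of 2-forms. -/

section FormAlgebra

open Matrix

/-- The skew-symmetric matrix of the 2-form with self-dual coordinates `u` and anti-self-dual
coordinates `v`. -/
def skewMat (u v : Fin 3 → ℝ) : Matrix (Fin 4) (Fin 4) ℝ :=
  !![0, u 0 + v 0, u 1 + v 1, u 2 + v 2;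
    -(u 0 + v 0), 0, u 2 - v 2, -(u 1 - v 1);
    -(u 1 + v 1), -(u 2 - v 2), 0, u 0 - v 0;
    -(u 2 + v 2), u 1 - v 1, -(u 0 - v 0), 0]

theorem skewMat_transpose (u v : Fin 3 → ℝ) : (skewMat u v)ᵀ = -skewMat u v := by
  ext i j
  fin_cases i <;> fin_cases j <;> simp [skewMat]

-- Negating the anti-self-dual part is the Hodge star, so this is the polarization of `W · ⋆W =
-- -Pf(W)`. It supplies quaternion-like relations without a compatible metric.
set_option maxHeartbeats 1000000 in
theorem skewMat_mul_add_mul (u v u' v' : Fin 3 → ℝ) :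
    skewMat u v * skewMat u' (-v') + skewMat u' v' * skewMat u (-v)
      = -(2 * (u ⬝ᵥ u' - v ⬝ᵥ v')) • (1 : Matrix (Fin 4) (Fin 4) ℝ) := by
  ext i j
  fin_cases i <;> fin_cases j <;>
    simp [skewMat, dotProduct, Fin.sum_univ_three] <;> ring

theorem trace_skewMat_mul (u v : Fin 3 → Fin 3 → ℝ) :
    (skewMat (u 0) (v 0) * skewMat (u 1) (-v 1) * skewMat (u 2) (v 2)).trace
      = 4 * ((Matrix.of u).det + (Matrix.of v).det) := by
  simp [skewMat, Fin.sum_univ_four, Matrix.trace, Matrix.det_fin_three]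
  ring

/-- Orthonormality for the form of signature `(3, 3)` says `U Uᵀ = 1 + V Vᵀ`, which forces `|det V|
< |det U|`. -/
theorem abs_det_lt_of_orthonormal {u v : Fin 3 → Fin 3 → ℝ}
    (h : ∀ i j, u i ⬝ᵥ u j - v i ⬝ᵥ v j = if i = j then 1 else 0) (hu : 0 < (Matrix.of u).det) :
    0 < (Matrix.of u).det + (Matrix.of v).det := by
  have hU : (Matrix.of u) * (Matrix.of u)ᵀ = 1 + (Matrix.of v) * (Matrix.of v)ᵀ := by
    ext i j
    have := h i j
    rw [Matrix.add_apply, Matrix.one_apply, ← this]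
    simp only [Matrix.mul_apply, dotProduct, Matrix.transpose_apply, Matrix.of_apply]
    ring
  have hdet := congrArg Matrix.det hU
  rw [Matrix.det_mul, Matrix.det_transpose] at hdet
  -- The determinant of `1 + V Vᵀ` is the sum of the squares of all minors of `V`, of sizes 0 to 3
  -- (Cauchy–Binet).
  have hV : (1 + (Matrix.of v) * (Matrix.of v)ᵀ).det = 1 + (Matrix.of v).det ^ 2
      + (∑ i, ∑ j, v i j ^ 2)
      + ∑ i : Fin 3, ((v 0 (i + 1) * v 1 (i + 2) - v 0 (i + 2) * v 1 (i + 1)) ^ 2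
        + (v 1 (i + 1) * v 2 (i + 2) - v 1 (i + 2) * v 2 (i + 1)) ^ 2
        + (v 2 (i + 1) * v 0 (i + 2) - v 2 (i + 2) * v 0 (i + 1)) ^ 2) := by
    simp [Matrix.det_fin_three, Matrix.mul_apply, Fin.sum_univ_three]
    ring
  have hlt : (Matrix.of v).det ^ 2 < (Matrix.of u).det ^ 2 := by
    rw [pow_two (Matrix.of u).det, hdet, hV]
    have h1 : 0 ≤ ∑ i, ∑ j, v i j ^ 2 := by positivity
    have h2 : 0 ≤ ∑ i : Fin 3, ((v 0 (i + 1) * v 1 (i + 2) - v 0 (i + 2) * v 1 (i + 1)) ^ 2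
        + (v 1 (i + 1) * v 2 (i + 2) - v 1 (i + 2) * v 2 (i + 1)) ^ 2
        + (v 2 (i + 1) * v 0 (i + 2) - v 2 (i + 2) * v 0 (i + 1)) ^ 2) := by positivity
    linarith
  have := abs_lt_of_sq_lt_sq hlt hu.le
  linarith [(abs_lt.1 this).1]

/-- Three skew-symmetric matrices `W` that generate a quaternionic structure, together with
their Hodge duals `V`. -/
structure QuaternionicTriple (W V : Fin 3 → Matrix (Fin 4) (Fin 4) ℝ) : Prop where
  skew : ∀ i, (W i)ᵀ = -W i
  skew_dual : ∀ i, (V i)ᵀ = -V i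
  mul_dual : ∀ i, W i * V i = -1
  dual_mul : ∀ i, V i * W i = -1
  anticomm : ∀ i j, i ≠ j → W i * V j = -(W j * V i)
  anticomm_dual : ∀ i j, i ≠ j → V i * W j = -(V j * W i)

namespace QuaternionicTriple

variable {W V : Fin 3 → Matrix (Fin 4) (Fin 4) ℝ}

theorem cycle (h : QuaternionicTriple W V) :
    QuaternionicTriple (fun i => W (i + 1)) (fun i => V (i + 1)) where
  skew _ := h.skew _
  skew_dual _ := h.skew_dual _
  mul_dual _ := h.mul_dual _
  dual_mul _ := h.dual_mul _
  anticomm _ _ hij := h.anticomm _ _ fun e => hij (add_right_cancel e)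
  anticomm_dual _ _ hij := h.anticomm_dual _ _ fun e => hij (add_right_cancel e)

theorem dot_self (h : QuaternionicTriple W V) (i : Fin 3) (x : Fin 4 → ℝ) :
    x ⬝ᵥ W i *ᵥ x = 0 := by
  have h1 : x ⬝ᵥ W i *ᵥ x = x ⬝ᵥ (W i)ᵀ *ᵥ x := by
    rw [dotProduct_mulVec, ← mulVec_transpose, dotProduct_comm]
  rw [h.skew, neg_mulVec, dotProduct_neg] at h1
  linarith

/-- Cyclic invariance of `W 0 * V 1 * W 2`, so the same scale `c` appears for all three forms of the
triple. -/
theorem product_cycle (h : QuaternionicTriple W V) : W 1 * V 2 * W 0 = W 0 * V 1 * W 2 := by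
  rw [Matrix.mul_assoc, h.anticomm_dual 2 0 (by decide), Matrix.mul_neg, ← Matrix.mul_assoc,
    h.anticomm 1 0 (by decide), Matrix.neg_mul, neg_neg]

/-- The vectors `x`, `V₁W₂x`, `V₂W₀x`, `V₀W₁x` play the role of `1, i, j, k` applied to `x`. Only
the entries of `W 0` are computed; those of `W 1` and `W 2` come from `cycle`. -/
theorem frame_values (h : QuaternionicTriple W V) (x : Fin 4 → ℝ) :
    x ⬝ᵥ W 0 *ᵥ ((V 1 * W 2) *ᵥ x) = x ⬝ᵥ (W 0 * V 1 * W 2) *ᵥ x ∧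
    x ⬝ᵥ W 0 *ᵥ ((V 2 * W 0) *ᵥ x) = 0 ∧
    x ⬝ᵥ W 0 *ᵥ ((V 0 * W 1) *ᵥ x) = 0 ∧
    ((V 2 * W 0) *ᵥ x) ⬝ᵥ W 0 *ᵥ ((V 0 * W 1) *ᵥ x) = x ⬝ᵥ (W 0 * V 1 * W 2) *ᵥ x ∧
    ((V 1 * W 2) *ᵥ x) ⬝ᵥ W 0 *ᵥ ((V 2 * W 0) *ᵥ x) = 0 ∧
    ((V 1 * W 2) *ᵥ x) ⬝ᵥ W 0 *ᵥ ((V 0 * W 1) *ᵥ x) = 0 := by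
  have ht : ∀ i j : Fin 3, (V i * W j)ᵀ = W j * V i := by
    intro i j
    rw [transpose_mul, h.skew, h.skew_dual, Matrix.neg_mul, Matrix.mul_neg, neg_neg]
  have hm : ∀ (P Q R : Matrix (Fin 4) (Fin 4) ℝ),
      (P *ᵥ x) ⬝ᵥ Q *ᵥ (R *ᵥ x) = x ⬝ᵥ (Pᵀ * (Q * R)) *ᵥ x := by
    intro P Q R
    rw [← mulVec_mulVec, ← mulVec_mulVec, dotProduct_mulVec x Pᵀ, ← mulVec_transpose,
      transpose_transpose]
  have e1 : W 0 * (V 0 * W 1) = -W 1 := by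
    rw [← Matrix.mul_assoc, h.mul_dual, Matrix.neg_mul, Matrix.one_mul]
  have e2 : W 0 * (V 2 * W 0) = W 2 := by
    rw [← Matrix.mul_assoc, h.anticomm 0 2 (by decide), Matrix.neg_mul, Matrix.mul_assoc,
      h.dual_mul, Matrix.mul_neg, Matrix.mul_one, neg_neg]
  refine ⟨?_, ?_, ?_, ?_, ?_, ?_⟩
  · rw [mulVec_mulVec, ← Matrix.mul_assoc]
  · rw [mulVec_mulVec, e2, h.dot_self]
  · rw [mulVec_mulVec, e1, neg_mulVec, dotProduct_neg, h.dot_self, neg_zero]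
  · rw [hm, ht, e1, Matrix.mul_neg, Matrix.mul_assoc, h.anticomm_dual 2 1 (by decide),
      Matrix.mul_neg, neg_neg, Matrix.mul_assoc]
  · rw [hm, ht, e2, h.anticomm 2 1 (by decide), Matrix.neg_mul, Matrix.mul_assoc, h.dual_mul,
      Matrix.mul_neg, Matrix.mul_one, neg_neg, h.dot_self]
  · rw [hm, ht, e1, Matrix.mul_neg, Matrix.mul_assoc, h.dual_mul, Matrix.mul_neg,
      Matrix.mul_one, neg_neg, h.dot_self]

end QuaternionicTriple

theorem quaternionicTriple_skewMat {u v : Fin 3 → Fin 3 → ℝ}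
    (h : ∀ i j, u i ⬝ᵥ u j - v i ⬝ᵥ v j = if i = j then 1 else 0) :
    QuaternionicTriple (fun i => skewMat (u i) (v i)) (fun i => skewMat (u i) (-v i)) where
  skew _ := skewMat_transpose _ _
  skew_dual _ := skewMat_transpose _ _
  mul_dual i := by
    have := skewMat_mul_add_mul (u i) (v i) (u i) (v i)
    rw [h, if_pos rfl, ← two_smul ℝ, mul_one, neg_smul, ← smul_neg] at this
    exact smul_right_injective _ two_ne_zero this
  dual_mul i := by
    have := skewMat_mul_add_mul (u i) (-v i) (u i) (-v i)
    rw [neg_dotProduct, dotProduct_neg, neg_neg, neg_neg, h, if_pos rfl, ← two_smul ℝ, mul_one,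
      neg_smul, ← smul_neg] at this
    exact smul_right_injective _ two_ne_zero this
  anticomm i j hij := by
    have := skewMat_mul_add_mul (u i) (v i) (u j) (v j)
    rw [h, if_neg hij, mul_zero, neg_zero, zero_smul] at this
    exact eq_neg_of_add_eq_zero_left this
  anticomm_dual i j hij := by
    have := skewMat_mul_add_mul (u i) (-v i) (u j) (-v j)
    rw [neg_dotProduct, dotProduct_neg, neg_neg, neg_neg, neg_neg, h, if_neg hij, mul_zero,
      neg_zero, zero_smul] at this
    exact eq_neg_of_add_eq_zero_left this

theorem eq_skewMat_single {M : Matrix (Fin 4) (Fin 4) ℝ} (hM : ∀ a b, M a b = -M b a)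
    {u : Fin 3 → ℝ} (h1 : M 0 1 = u 0) (h2 : M 0 2 = u 1) (h3 : M 0 3 = u 2)
    (h4 : M 2 3 = u 0) (h5 : M 1 2 = u 2) (h6 : M 3 1 = u 1) : M = skewMat u 0 := by
  have hd : ∀ a, M a a = 0 := fun a => by linarith [hM a a]
  have h1' := hM 1 0
  have h2' := hM 2 0
  have h3' := hM 3 0
  have h4' := hM 3 2
  have h5' := hM 2 1
  have h6' := hM 1 3
  ext a b
  fin_cases a <;> fin_cases b <;> simp [skewMat, hd, h1, h2, h3, h4, h5, h6, h1', h2',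
    h3', h4', h5', h6']

/-- The quadratic form `x·(W₀V₁W₂)x` is the conformal metric belonging to the triple. Its trace is
`4 (det U + det V) > 0`, so it is positive on some coordinate vector, and a single such vector
generates the whole frame. -/
theorem exists_normalForm {u v : Fin 3 → Fin 3 → ℝ}
    (h : ∀ i j, u i ⬝ᵥ u j - v i ⬝ᵥ v j = if i = j then 1 else 0) (hu : 0 < (Matrix.of u).det) :
    ∃ (M : Matrix (Fin 4) (Fin 4) ℝ) (c : ℝ), 0 < c ∧
      ∀ i, Mᵀ * skewMat (u i) (v i) * M = c • skewMat (Pi.single i 1) 0 := by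
  have hq := quaternionicTriple_skewMat h
  set W := fun i => skewMat (u i) (v i)
  set V := fun i => skewMat (u i) (-v i)
  obtain ⟨k, hk⟩ : ∃ k, 0 < (W 0 * V 1 * W 2) k k := by
    by_contra! hneg
    have h1 := trace_skewMat_mul u v
    have h2 := abs_det_lt_of_orthonormal h hu
    have h3 : (W 0 * V 1 * W 2).trace ≤ 0 := Finset.sum_nonpos fun k _ => hneg k
    change (W 0 * V 1 * W 2).trace = _ at h1
    linarith
  let x : Fin 4 → ℝ := Pi.single k 1
  have hc : x ⬝ᵥ (W 0 * V 1 * W 2) *ᵥ x = (W 0 * V 1 * W 2) k k := by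
    simp [x]
  set c := (W 0 * V 1 * W 2) k k
  let y : Fin 4 → Fin 4 → ℝ :=
    ![x, (V 1 * W 2) *ᵥ x, (V 2 * W 0) *ᵥ x, (V 0 * W 1) *ᵥ x]
  refine ⟨(Matrix.of y)ᵀ, c, hk, ?_⟩
  have hentry : ∀ i a b, ((Matrix.of y)ᵀᵀ * W i * (Matrix.of y)ᵀ) a b = y a ⬝ᵥ W i *ᵥ y b := by
    intro i a b
    rw [transpose_transpose, Matrix.mul_assoc, Matrix.mul_apply, dotProduct]
    rfl
  have hanti : ∀ i a b, y a ⬝ᵥ W i *ᵥ y b = -(y b ⬝ᵥ W i *ᵥ y a) := by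
    intro i a b
    rw [dotProduct_mulVec, ← mulVec_transpose, hq.skew, neg_mulVec, neg_dotProduct,
      dotProduct_comm]
  obtain ⟨a1, a2, a3, a4, a5, a6⟩ := hq.frame_values x
  obtain ⟨b1, b2, b3, b4, b5, b6⟩ := hq.cycle.frame_values x
  obtain ⟨c1, c2, c3, c4, c5, c6⟩ := hq.cycle.cycle.frame_values x
  have p1 := hq.product_cycle
  have p2 := hq.cycle.product_cycle
  simp only [Fin.isValue, zero_add, show (1 : Fin 3) + 1 = 2 from rfl,
    show (2 : Fin 3) + 1 = 0 from rfl] at b1 b2 b3 b4 b5 b6 c1 c2 c3 c4 c5 c6 p2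
  rw [p1, hc] at b1 b4
  rw [p2, p1, hc] at c1 c4
  rw [hc] at a1 a4
  have hall : ∀ i, ((Matrix.of y)ᵀᵀ * W i * (Matrix.of y)ᵀ) =
      skewMat (Pi.single i c) 0 := by
    intro i
    refine eq_skewMat_single (fun a b => by rw [hentry, hentry, hanti]) ?_ ?_ ?_ ?_ ?_ ?_ <;>
      rw [hentry] <;> fin_cases i
    -- The families `a`, `b`, `c` are the entries of `W 0`, `W 1`, `W 2`. The cyclic shift permutes
    -- the last three frame vectors, which is why some entries are reached only through
    -- antisymmetry.
    exacts [a1, b3, c2, a2, b1, c3, a3, b2, c1,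
      a4, b5, (hanti _ _ _).trans (neg_eq_zero.2 c6),
      a5, (hanti _ _ _).trans (neg_eq_zero.2 b6), c4,
      (hanti _ _ _).trans (neg_eq_zero.2 a6), b4, c5]
  intro i
  change (Matrix.of y)ᵀᵀ * W i * (Matrix.of y)ᵀ = _
  rw [hall]
  ext a b
  fin_cases i <;> fin_cases a <;> fin_cases b <;> simp [skewMat]

end FormAlgebra

/-! ### From wedge-positive triples of forms to self-dual frames. -/

section FormFrames

set_option maxSynthPendingDepth 4

open Matrix

/-- Gram–Schmidt for a form that is positive only on the span of `Ω`. The positive diagonal `a`,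
`c`, `g` is kept explicit because it preserves signs of determinants and the sign of the last
bracket coordinate. -/
theorem exists_triangular_orthonormal {V : Type*} [AddCommGroup V] [Module ℝ V]
    (B : LinearMap.BilinForm ℝ V) (hs : ∀ x y, B x y = B y x) (Ω : Fin 3 → V)
    (hpos : ∀ c : Fin 3 → ℝ, c ≠ 0 → 0 < B (∑ i, c i • Ω i) (∑ i, c i • Ω i)) :
    ∃ (η : Fin 3 → V) (a b c d f g : ℝ), 0 < a ∧ 0 < c ∧ 0 < g ∧
      Ω 0 = a • η 0 ∧ Ω 1 = b • η 0 + c • η 1 ∧ Ω 2 = d • η 0 + f • η 1 + g • η 2 ∧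
      (∀ i, η i ∈ Submodule.span ℝ (Set.range Ω)) ∧
      ∀ i j, B (η i) (η j) = if i = j then 1 else 0 := by
  have hpos' : ∀ x y z : ℝ, (x ≠ 0 ∨ y ≠ 0 ∨ z ≠ 0) →
      0 < B (x • Ω 0 + y • Ω 1 + z • Ω 2) (x • Ω 0 + y • Ω 1 + z • Ω 2) := by
    intro x y z h
    have := hpos ![x, y, z] (by
      intro h0
      have h1 := congrFun h0 0
      have h2 := congrFun h0 1
      have h3 := congrFun h0 2
      simp at h1 h2 h3
      tauto)
    simpa [Fin.sum_univ_three] using this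
  have normalize : ∀ x : V, 0 < B x x → ∃ r : ℝ, 0 < r ∧ B (r⁻¹ • x) (r⁻¹ • x) = 1 := by
    intro x hx
    refine ⟨√(B x x), Real.sqrt_pos.2 hx, ?_⟩
    have h0 : √(B x x) ≠ 0 := (Real.sqrt_pos.2 hx).ne'
    have h1 := Real.sq_sqrt hx.le
    simp only [map_smul, LinearMap.smul_apply, smul_eq_mul]
    field_simp
    exact h1.symm
  have hmem : ∀ i, Ω i ∈ Submodule.span ℝ (Set.range Ω) := fun i =>
    Submodule.subset_span (Set.mem_range_self i)
  obtain ⟨a, ha, h00⟩ := normalize (Ω 0) (by simpa using hpos' 1 0 0 (by simp))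
  set η0 := a⁻¹ • Ω 0 with hη0
  have hm0 : η0 ∈ Submodule.span ℝ (Set.range Ω) := Submodule.smul_mem _ _ (hmem 0)
  set b := B (Ω 1) η0
  obtain ⟨c, hc, h11⟩ := normalize (Ω 1 - b • η0) (by
    have := hpos' (-(b * a⁻¹)) 1 0 (by simp)
    convert this using 3 <;> (rw [hη0]; module))
  set η1 := c⁻¹ • (Ω 1 - b • η0) with hη1
  have hm1 : η1 ∈ Submodule.span ℝ (Set.range Ω) :=
    Submodule.smul_mem _ _ (Submodule.sub_mem _ (hmem 1) (Submodule.smul_mem _ _ hm0))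
  have h10 : B η1 η0 = 0 := by
    simp [hη1, h00, b]
  set d := B (Ω 2) η0
  set f := B (Ω 2) η1
  obtain ⟨g, hg, h22⟩ := normalize (Ω 2 - d • η0 - f • η1) (by
    have := hpos' (-(d * a⁻¹) + f * c⁻¹ * b * a⁻¹) (-(f * c⁻¹)) 1 (by simp)
    convert this using 3 <;> (rw [hη1, hη0]; module))
  set η2 := g⁻¹ • (Ω 2 - d • η0 - f • η1) with hη2
  have hm2 : η2 ∈ Submodule.span ℝ (Set.range Ω) :=
    Submodule.smul_mem _ _ (Submodule.sub_mem _ (Submodule.sub_mem _ (hmem 2)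
      (Submodule.smul_mem _ _ hm0)) (Submodule.smul_mem _ _ hm1))
  have h01 : B η0 η1 = 0 := by rw [hs, h10]
  have h20 : B η2 η0 = 0 := by
    simp [hη2, h00, h10, d]
  have h21 : B η2 η1 = 0 := by
    simp [hη2, h01, h11, f]
  have h02 : B η0 η2 = 0 := by rw [hs, h20]
  have h12 : B η1 η2 = 0 := by rw [hs, h21]
  refine ⟨![η0, η1, η2], a, b, c, d, f, g, ha, hc, hg, ?_, ?_, ?_, ?_, ?_⟩
  · change Ω 0 = a • η0
    rw [hη0, smul_inv_smul₀ ha.ne']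
  · change Ω 1 = b • η0 + c • η1
    rw [hη1, smul_inv_smul₀ hc.ne']
    abel
  · change Ω 2 = d • η0 + f • η1 + g • η2
    rw [hη2, smul_inv_smul₀ hg.ne']
    abel
  · intro i
    fin_cases i
    exacts [hm0, hm1, hm2]
  · intro i j
    fin_cases i <;> fin_cases j
    exacts [h00, h01, h02, h10, h11, h12, h20, h21, h22]

/-- The submodule of 2-forms. -/
def altForms : Submodule ℝ Bil where
  carrier := {α | ∀ v, α v v = 0}
  zero_mem' := by simp
  add_mem' := by
    intro α β h k v
    simp [h v, k v]
  smul_mem' := by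
    intro c α h v
    simp [h v]

theorem altForms_swap {α : Bil} (h : α ∈ altForms) (v w : E4) : α v w = -α w v := by
  have h1 := h (v + w)
  simp only [map_add, LinearMap.add_apply, h v, h w] at h1
  linarith

variable (e : Module.Basis (Fin 4) ℝ E4)

/-- The self-dual coordinates of a 2-form. -/
def plusCoord : Bil →ₗ[ℝ] (Fin 3 → ℝ) where
  toFun α := ![(α (e 0) (e 1) + α (e 2) (e 3)) / 2, (α (e 0) (e 2) + α (e 3) (e 1)) / 2,
    (α (e 0) (e 3) + α (e 1) (e 2)) / 2]
  map_add' α β := by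
    ext i
    fin_cases i <;> simp <;> ring
  map_smul' c α := by
    ext i
    fin_cases i <;> simp <;> ring

/-- The anti-self-dual coordinates of a 2-form. -/
def minusCoord : Bil →ₗ[ℝ] (Fin 3 → ℝ) where
  toFun α := ![(α (e 0) (e 1) - α (e 2) (e 3)) / 2, (α (e 0) (e 2) - α (e 3) (e 1)) / 2,
    (α (e 0) (e 3) - α (e 1) (e 2)) / 2]
  map_add' α β := by
    ext i
    fin_cases i <;> simp <;> ring
  map_smul' c α := by
    ext i
    fin_cases i <;> simp <;> ring

/-- Half the wedge product, in self-dual and anti-self-dual coordinates. -/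
def wedgeForm : LinearMap.BilinForm ℝ Bil :=
  LinearMap.mk₂ ℝ
    (fun α β => plusCoord e α ⬝ᵥ plusCoord e β - minusCoord e α ⬝ᵥ minusCoord e β)
    (by intros; simp only [map_add, add_dotProduct]; ring)
    (by intros; simp only [map_smul, smul_dotProduct, smul_eq_mul]; ring)
    (by intros; simp only [map_add, dotProduct_add]; ring)
    (by intros; simp only [map_smul, dotProduct_smul, smul_eq_mul]; ring)

theorem wedgeForm_apply (α β : Bil) : wedgeForm e α β =
    plusCoord e α ⬝ᵥ plusCoord e β - minusCoord e α ⬝ᵥ minusCoord e β := rfl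

variable {e}

theorem wedge_eq {α β : Bil} (hα : α ∈ altForms) (hβ : β ∈ altForms) :
    wedge e α β = 2 * wedgeForm e α β := by
  simp only [wedge, wedgeForm_apply, plusCoord, minusCoord, dotProduct, Fin.sum_univ_three,
    LinearMap.coe_mk, AddHom.coe_mk, cons_val_zero, cons_val_one, cons_val,
    altForms_swap hα (e 3) (e 1), altForms_swap hβ (e 3) (e 1)]
  ring

theorem formMatrix_eq {α : Bil} (hα : α ∈ altForms) :
    formMatrix e α = skewMat (plusCoord e α) (minusCoord e α) := by
  have h := hα
  ext i j
  fin_cases i <;> fin_cases j <;>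
    simp [formMatrix, skewMat, plusCoord, minusCoord, altForms_swap hα (e 3) (e 1),
      altForms_swap hα (e 1) (e 0), altForms_swap hα (e 2) (e 0), altForms_swap hα (e 3) (e 0),
      altForms_swap hα (e 2) (e 1), altForms_swap hα (e 3) (e 2), h (e 0), h (e 1), h (e 2),
      h (e 3)] <;> ring

theorem formMatrix_add (α β : Bil) :
    formMatrix e (α + β) = formMatrix e α + formMatrix e β := rfl

theorem formMatrix_smul (c : ℝ) (α : Bil) : formMatrix e (c • α) = c • formMatrix e α := rfl

theorem formMatrix_neg (α : Bil) : formMatrix e (-α) = -formMatrix e α := rfl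

theorem formMatrix_injective {α β : Bil} (h : formMatrix e α = formMatrix e β) : α = β :=
  LinearMap.BilinForm.ext_basis e fun i j => congrFun (congrFun h i) j

theorem formMatrix_map (M : Matrix (Fin 4) (Fin 4) ℝ) (hM : IsUnit M.det) (α : Bil) :
    formMatrix (e.map (Matrix.toLinearEquiv e M hM)) α = Mᵀ * formMatrix e α * M := by
  ext a b
  have he : ∀ j, Matrix.toLinearEquiv e M hM (e j) = ∑ i, M i j • e i := fun j =>
    Matrix.toLin_self e e M j
  simp only [formMatrix, Matrix.of_apply, Module.Basis.map_apply, he, map_sum, map_smul,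
    LinearMap.sum_apply, LinearMap.smul_apply, smul_eq_mul, Matrix.mul_apply,
    Matrix.transpose_apply, Finset.sum_mul]
  refine Finset.sum_congr rfl fun j _ => ?_
  rw [Finset.mul_sum]
  exact Finset.sum_congr rfl fun i _ => by ring

theorem mem_dualForms_iff {α : Bil} :
    α ∈ dualForms e 1 ↔ α ∈ altForms ∧ minusCoord e α = 0 := by
  constructor
  · rintro ⟨h0, h1, h2, h3⟩
    refine ⟨h0, ?_⟩
    ext i
    fin_cases i <;> simp [minusCoord, h1, h2, h3]
  · rintro ⟨h0, h⟩
    have h1 := congrFun h 0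
    have h2 := congrFun h 1
    have h3 := congrFun h 2
    simp only [minusCoord, LinearMap.coe_mk, AddHom.coe_mk, cons_val_zero, cons_val_one, cons_val,
      Pi.zero_apply] at h1 h2 h3
    exact ⟨h0, by linarith, by linarith, by linarith⟩

theorem dotProduct_self_pos {x : Fin 3 → ℝ} (hx : x ≠ 0) : 0 < x ⬝ᵥ x := by
  refine lt_of_le_of_ne ?_ fun h => hx (dotProduct_self_eq_zero.1 h.symm)
  exact Finset.sum_nonneg fun _ _ => mul_self_nonneg _

theorem dotProduct_self_nonneg (x : Fin 3 → ℝ) : 0 ≤ x ⬝ᵥ x :=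
  Finset.sum_nonneg fun _ _ => mul_self_nonneg _

theorem eq_zero_of_coords {α : Bil} (hα : α ∈ altForms) (hp : plusCoord e α = 0)
    (hm : minusCoord e α = 0) : α = 0 := by
  apply formMatrix_injective (e := e)
  rw [formMatrix_eq hα, hp, hm]
  ext i j
  fin_cases i <;> fin_cases j <;> simp [skewMat, formMatrix]

/-- The wedge product is nonpositive on forms without self-dual part, so a positive subspace injects
into the three-dimensional `Λ⁺`. -/
theorem finrank_le_of_isDefiniteSubspace {V : Submodule ℝ Bil} (hV : IsDefiniteSubspace V) :
    Module.finrank ℝ V ≤ 3 := by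
  obtain ⟨halt, e, he⟩ := hV
  have hinj : Function.Injective ((plusCoord e).comp V.subtype) := by
    rintro ⟨α, hα⟩ ⟨β, hβ⟩ hαβ
    by_contra hne
    have hmem := V.sub_mem hα hβ
    have h1 := he _ hmem fun h => hne (Subtype.ext (sub_eq_zero.1 h))
    have h0 : plusCoord e (α - β) = 0 := by
      rw [map_sub, sub_eq_zero]
      exact hαβ
    rw [wedge_eq (halt _ hmem) (halt _ hmem), wedgeForm_apply, h0, zero_dotProduct] at h1
    linarith [dotProduct_self_nonneg (minusCoord e (α - β))]
  simpa using LinearMap.finrank_le_finrank_of_injective hinj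

theorem isDefiniteSubspace_dualForms (e : Module.Basis (Fin 4) ℝ E4) :
    IsDefiniteSubspace (dualForms e 1) := by
  refine ⟨fun α hα => hα.1, e, fun α hα hne => ?_⟩
  obtain ⟨halt, hm⟩ := mem_dualForms_iff.1 hα
  rw [wedge_eq halt halt, wedgeForm_apply, hm, zero_dotProduct, sub_zero]
  have := dotProduct_self_pos fun hp => hne (eq_zero_of_coords halt hp hm)
  linarith

theorem dualFrame_mem_altForms (e : Module.Basis (Fin 4) ℝ E4) (ε : ℝ) (k : Fin 3) :
    dualFrame e ε k ∈ altForms := by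
  intro v
  fin_cases k <;> simp [dualFrame, wedgeCovectors, mul_comm]

theorem plusCoord_dualFrame (e : Module.Basis (Fin 4) ℝ E4) (k : Fin 3) :
    plusCoord e (dualFrame e 1 k) = Pi.single k 1 := by
  ext i
  fin_cases k <;> fin_cases i <;>
    simp [plusCoord, dualFrame, wedgeCovectors]

theorem minusCoord_dualFrame (e : Module.Basis (Fin 4) ℝ E4) (k : Fin 3) :
    minusCoord e (dualFrame e 1 k) = 0 := by
  ext i
  fin_cases k <;> fin_cases i <;>
    simp [minusCoord, dualFrame, wedgeCovectors]

theorem finrank_dualForms (e : Module.Basis (Fin 4) ℝ E4) :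
    Module.finrank ℝ (dualForms e 1) = 3 := by
  refine le_antisymm (finrank_le_of_isDefiniteSubspace (isDefiniteSubspace_dualForms e)) ?_
  have hsurj : Function.Surjective ((plusCoord e).comp (dualForms e 1).subtype) := by
    intro x
    refine ⟨⟨∑ k, x k • dualFrame e 1 k, Submodule.sum_mem _ fun k _ => Submodule.smul_mem _ _
      (mem_dualForms_iff.2 ⟨dualFrame_mem_altForms e 1 k, minusCoord_dualFrame e k⟩)⟩, ?_⟩
    simp only [LinearMap.comp_apply, Submodule.subtype_apply, map_sum, map_smul,
      plusCoord_dualFrame]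
    ext i
    simp [Pi.single_apply]
  simpa using LinearMap.finrank_le_finrank_of_surjective hsurj

theorem maximal_dualForms (e : Module.Basis (Fin 4) ℝ E4) :
    Maximal IsDefiniteSubspace (dualForms e 1) := by
  refine ⟨isDefiniteSubspace_dualForms e, fun V hV hle => ?_⟩
  have : FiniteDimensional ℝ Bil := inferInstance
  refine (Submodule.eq_of_le_of_finrank_le (K := ℝ) (V := Bil) hle ?_).ge
  rw [finrank_dualForms]
  exact finrank_le_of_isDefiniteSubspace hV

theorem HasFormOrientation.neg {α : Fin 3 → Bil} {s : SignType}
    (h : HasFormOrientation e α s) : HasFormOrientation e (fun k => -α k) (-s) := by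
  obtain ⟨r, hr, h⟩ := h
  refine ⟨-r, by rw [← hr, Pi.neg_apply, Left.sign_neg], ?_⟩
  simpa only [formMatrix_neg, neg_mul_neg, Pi.neg_apply, neg_smul_neg] using h

/-- The source of the orientation `-1` below: the standard self-dual triple has first bracket `-2`
times its third member. -/
theorem skewMat_single_mul : skewMat (Pi.single 0 1) 0 * skewMat (Pi.single 1 1) 0
      = -skewMat (Pi.single 2 1) 0 ∧
    skewMat (Pi.single 1 1) 0 * skewMat (Pi.single 0 1) 0 = skewMat (Pi.single 2 1) 0 := by
  constructor <;>
  · ext i j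
    fin_cases i <;> fin_cases j <;> simp [skewMat]

theorem isUnit_det_of_normalForm {W M : Matrix (Fin 4) (Fin 4) ℝ} {c : ℝ} (hc : 0 < c)
    (h : Mᵀ * W * M = c • skewMat (Pi.single 0 1) 0) : IsUnit M.det := by
  have hJ : skewMat (Pi.single 0 1) 0 * skewMat (Pi.single 0 1) 0 = -1 := by
    ext i j
    fin_cases i <;> fin_cases j <;> simp [skewMat]
  have h1 := congrArg Matrix.det hJ
  rw [Matrix.det_mul, Matrix.det_neg, Matrix.det_one] at h1
  have h2 := congrArg Matrix.det h
  rw [Matrix.det_mul, Matrix.det_smul] at h2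
  rw [isUnit_iff_ne_zero]
  intro h0
  rw [h0, mul_zero] at h2
  have h3 : (skewMat (Pi.single 0 1) 0).det = 0 :=
    (mul_eq_zero.1 h2.symm).resolve_left (by positivity)
  rw [h3] at h1
  norm_num at h1

/-- After Gram–Schmidt, `exists_normalForm` provides the change of basis that turns the orthonormal
triple into a multiple of the standard self-dual one. -/
theorem exists_selfDual_frame {Ω : Fin 3 → Bil} (halt : ∀ k, Ω k ∈ altForms)
    (hpos : ∀ c : Fin 3 → ℝ, c ≠ 0 → 0 < wedgeForm e (∑ k, c k • Ω k) (∑ k, c k • Ω k))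
    (hdet : 0 < (Matrix.of fun k => plusCoord e (Ω k)).det) :
    ∃ e' : Module.Basis (Fin 4) ℝ E4, Submodule.span ℝ (Set.range Ω) = dualForms e' 1 ∧
      HasFormOrientation e' Ω (-1) := by
  obtain ⟨η, a, b, c, d, f, g, ha, hc, hg, h0, h1, h2, hmem, horth⟩ :=
    exists_triangular_orthonormal (wedgeForm e)
      (fun α β => by simp only [wedgeForm_apply, dotProduct_comm]) Ω hpos
  have hle : Submodule.span ℝ (Set.range Ω) ≤ altForms := by
    rw [Submodule.span_le]
    rintro _ ⟨k, rfl⟩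
    exact halt k
  have hηalt : ∀ k, η k ∈ altForms := fun k => hle (hmem k)
  have hdetη : 0 < (Matrix.of fun k => plusCoord e (η k)).det := by
    have : (Matrix.of fun k => plusCoord e (Ω k)).det
        = (a * c * g) * (Matrix.of fun k => plusCoord e (η k)).det := by
      simp only [Matrix.det_fin_three, Matrix.of_apply, h0, h1, h2, map_add, map_smul,
        Pi.add_apply, Pi.smul_apply, smul_eq_mul]
      ring
    rw [this] at hdet
    exact (pos_iff_pos_of_mul_pos hdet).1 (by positivity)
  obtain ⟨M, κ, hκ, hM⟩ := exists_normalForm (u := fun k => plusCoord e (η k))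
    (v := fun k => minusCoord e (η k)) horth hdetη
  have hunit := isUnit_det_of_normalForm hκ (hM 0)
  let e' := e.map (Matrix.toLinearEquiv e M hunit)
  have hη : ∀ k, formMatrix e' (η k) = κ • skewMat (Pi.single k 1) 0 := by
    intro k
    rw [← hM k, ← formMatrix_eq (hηalt k)]
    exact formMatrix_map M hunit (η k)
  have hηdual : ∀ k, minusCoord e' (η k) = 0 ∧ plusCoord e' (η k) = Pi.single k κ := by
    have hv : ∀ k i j, η k (e' i) (e' j) = κ * skewMat (Pi.single k 1) 0 i j := fun k i j =>
      congrFun (congrFun (hη k) i) j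
    intro k
    constructor <;>
    · ext i
      fin_cases k <;> fin_cases i <;> simp [minusCoord, plusCoord, hv, skewMat]
  refine ⟨e', le_antisymm ?_ ?_, ?_⟩
  · have hηmem : ∀ k, η k ∈ dualForms e' 1 := fun k =>
      mem_dualForms_iff.2 ⟨hηalt k, (hηdual k).1⟩
    rw [Submodule.span_le]
    rintro _ ⟨k, rfl⟩
    have hs := fun (t : ℝ) k => Submodule.smul_mem _ t (hηmem k)
    fin_cases k
    · change Ω 0 ∈ _
      rw [h0]; exact hs _ _
    · change Ω 1 ∈ _
      rw [h1]; exact Submodule.add_mem _ (hs _ _) (hs _ _)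
    · change Ω 2 ∈ _
      rw [h2]; exact Submodule.add_mem _ (Submodule.add_mem _ (hs _ _) (hs _ _)) (hs _ _)
  · intro α hα
    obtain ⟨hαalt, hαm⟩ := mem_dualForms_iff.1 hα
    have hsum : ∑ k, (plusCoord e' α k / κ) • η k ∈ Submodule.span ℝ (Set.range Ω) :=
      Submodule.sum_mem _ fun k _ => Submodule.smul_mem _ _ (hmem k)
    have : α - ∑ k, (plusCoord e' α k / κ) • η k = 0 := by
      refine eq_zero_of_coords (e := e') (Submodule.sub_mem _ hαalt (hle hsum)) ?_ ?_
      · rw [map_sub, map_sum, sub_eq_zero]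
        ext i
        simp only [map_smul, (hηdual _).2, Finset.sum_apply, Pi.smul_apply, Pi.single_apply,
          smul_eq_mul, mul_ite, mul_zero, Finset.sum_ite_eq, Finset.mem_univ, if_true]
        field_simp
      · simp [map_sub, map_sum, hαm, (hηdual _).1]
    rw [sub_eq_zero.1 this]
    exact hsum
  · obtain ⟨hJ, hJ'⟩ := skewMat_single_mul
    -- The bracket of `Ω 0` and `Ω 1` is `ac[η 0, η 1] = -2acκ η 2`; solving the triangular system
    -- for `η 2` gives the three coordinates from last to first.
    let r2 := -(2 * a * c * κ / g)
    let r1 := -(r2 * f / c)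
    refine ⟨![-((r1 * b + r2 * d) / a), r1, r2], ?_, ?_⟩
    · change SignType.sign r2 = -1
      rw [sign_eq_neg_one_iff]
      simp only [r2, Left.neg_neg_iff]
      positivity
    · have hg' := hg.ne'
      have hc' := hc.ne'
      have ha' := ha.ne'
      rw [Fin.sum_univ_three, h0, h1, h2]
      simp only [formMatrix_add, formMatrix_smul, hη, mul_add, add_mul, Matrix.smul_mul,
        Matrix.mul_smul, hJ, hJ', cons_val_zero, cons_val_one, cons_val, r1, r2]
      match_scalars <;> field_simp <;> ring

end FormFrames

/-! ### Algebraic curvature tensors and their blocks. -/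

section CurvatureTensors

set_option maxSynthPendingDepth 4

open Matrix

/-- The Plücker relation is `|x|² = |y|²`, so sums of unit self-dual and anti-self-dual forms are
decomposable. In the coordinates `s = x + y`, `t = x - y` it becomes `s·t = 0`. -/
theorem exists_decomposition {x y : Fin 3 → ℝ} (hx : x ⬝ᵥ x = 1) (hy : y ⬝ᵥ y = 1) :
    ∃ u v : Fin 4 → ℝ, ∀ i j, u i * v j - u j * v i = skewMat x y i j := by
  simp only [dotProduct, Fin.sum_univ_three] at hx hy
  set s := fun k => x k + y k with hs
  set t := fun k => x k - y k with ht
  have hst : s 0 * t 0 + s 1 * t 1 + s 2 * t 2 = 0 := by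
    simp only [hs, ht]
    linear_combination hx - hy
  have hskew : skewMat x y = !![0, s 0, s 1, s 2; -s 0, 0, t 2, -t 1; -s 1, -t 2, 0, t 0;
      -s 2, t 1, -t 0, 0] := rfl
  rw [hskew]
  clear_value s t
  -- If `s = 0`, the form lives on the last three coordinates, and two vectors orthogonal to `t` are
  -- wanted.
  by_cases h0 : s 0 ^ 2 + s 1 ^ 2 + s 2 ^ 2 = 0
  · have h1 : s 0 = 0 := by nlinarith [sq_nonneg (s 0), sq_nonneg (s 1), sq_nonneg (s 2)]
    have h2 : s 1 = 0 := by nlinarith [sq_nonneg (s 0), sq_nonneg (s 1), sq_nonneg (s 2)]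
    have h3 : s 2 = 0 := by nlinarith [sq_nonneg (s 0), sq_nonneg (s 1), sq_nonneg (s 2)]
    by_cases t0 : t 0 = 0
    · refine ⟨![0, 1, 0, 0], ![0, 0, t 2, -t 1], fun i j => ?_⟩
      fin_cases i <;> fin_cases j <;> simp [h1, h2, h3, t0]
    · refine ⟨![0, -t 1 / t 0, 1, 0], ![0, -t 2, 0, t 0], fun i j => ?_⟩
      fin_cases i <;> fin_cases j <;> simp [h1, h2, h3] <;> field_simp
  · let d := s 0 ^ 2 + s 1 ^ 2 + s 2 ^ 2
    -- The factors are `(1, (s × t)/|s|²)` and `(0, s)`: since `s·t = 0`, `(s × t) × s = |s|² t`.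
    refine ⟨![1, (t 2 * s 1 - t 1 * s 2) / d, (t 0 * s 2 - t 2 * s 0) / d,
      (t 1 * s 0 - t 0 * s 1) / d], ![0, s 0, s 1, s 2], fun i j => ?_⟩
    have hd : d ≠ 0 := h0
    fin_cases i <;> fin_cases j <;> simp <;> field_simp <;> simp only [d] <;>
      first
      | linear_combination s 0 * hst
      | linear_combination s 1 * hst
      | linear_combination s 2 * hst
      | linear_combination -s 0 * hst
      | linear_combination -s 1 * hst
      | linear_combination -s 2 * hst

/-- The symmetries of a curvature tensor: `r w z` is the 2-form `(u, v) ↦ ⟨R(u, v)w, z⟩`. -/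
structure IsCurvatureTensor (r : E4 → E4 → Bil) : Prop where
  alt : ∀ w z, r w z ∈ altForms
  swap : ∀ w z u v, r z w u v = -r w z u v
  bianchi : ∀ u v w z, r w z u v + r u z v w + r v z w u = 0

/-- The classical octahedron argument: combine four instances of the Bianchi identity. -/
theorem IsCurvatureTensor.pair_symm {r : E4 → E4 → Bil} (h : IsCurvatureTensor r)
    (u v w z : E4) : r w z u v = r u v w z := by
  have a := fun w z u v => altForms_swap (h.alt w z) u v
  have s := h.swap
  have b1 := h.bianchi u v w z
  have b2 := h.bianchi v w z u
  have b3 := h.bianchi w z u v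
  have b4 := h.bianchi z u v w
  linarith [s u z v w, s u v w z, a v u w z, a w u z v, a w v z u, s v w u z, a z v u w,
    s v z w u, a v w z u, s w z u v, s w u v z]

variable (e : Module.Basis (Fin 4) ℝ E4)

/-- The components of the curvature of `Λ⁺` (`ε = 1`) or `Λ⁻` (`ε = -1`) in the frame
`dualFrame e ε`. -/
def dualCurvature (r : E4 → E4 → Bil) (ε : ℝ) : Fin 3 → Bil :=
  ![r (e 1) (e 0) + ε • r (e 3) (e 2), r (e 2) (e 0) + ε • r (e 1) (e 3),
    r (e 3) (e 0) + ε • r (e 2) (e 1)]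

variable {e}

theorem dualCurvature_mem {r : E4 → E4 → Bil} (h : IsCurvatureTensor r) (ε : ℝ) (k : Fin 3) :
    dualCurvature e r ε k ∈ altForms := by
  fin_cases k <;> exact Submodule.add_mem _ (h.alt _ _) (Submodule.smul_mem _ _ (h.alt _ _))

theorem alt_apply_eq {α : Bil} (hα : α ∈ altForms) {u v : E4} {x y : Fin 3 → ℝ}
    (huv : ∀ i j, e.repr u i * e.repr v j - e.repr u j * e.repr v i = skewMat x y i j) :
    α u v = 2 * (x ⬝ᵥ plusCoord e α + y ⬝ᵥ minusCoord e α) := by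
  have h01 := huv 0 1
  have h02 := huv 0 2
  have h03 := huv 0 3
  have h12 := huv 1 2
  have h31 := huv 3 1
  have h23 := huv 2 3
  simp [skewMat] at h01 h02 h03 h12 h31 h23
  have hd : ∀ i, α (e i) (e i) = 0 := fun i => hα (e i)
  conv_lhs => rw [← e.sum_repr u, ← e.sum_repr v]
  simp only [map_add, map_smul, LinearMap.add_apply, LinearMap.smul_apply, smul_eq_mul,
    Fin.sum_univ_four, hd, altForms_swap hα (e 3) (e 0), altForms_swap hα (e 2) (e 0),
    altForms_swap hα (e 1) (e 0), altForms_swap hα (e 2) (e 1), altForms_swap hα (e 1) (e 3),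
    altForms_swap hα (e 3) (e 2), plusCoord, minusCoord, dotProduct, Fin.sum_univ_three,
    LinearMap.coe_mk, AddHom.coe_mk, cons_val_zero, cons_val_one, cons_val]
  linear_combination α (e 0) (e 1) * h01 + α (e 0) (e 2) * h02 + α (e 0) (e 3) * h03
    + α (e 1) (e 2) * h12 + α (e 3) (e 1) * h31 + α (e 2) (e 3) * h23

theorem plusCoord_eq_dualCurvature {r : E4 → E4 → Bil} (h : IsCurvatureTensor r) (u v : E4)
    (k : Fin 3) : plusCoord e (r v u) k = dualCurvature e r 1 k u v / 2 := by
  have hs : ∀ i j, r v u (e i) (e j) = r (e j) (e i) u v := fun i j => by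
    rw [h.pair_symm, altForms_swap (h.alt _ _), h.swap, neg_neg]
  fin_cases k <;> simp [plusCoord, dualCurvature, hs]

theorem minusCoord_eq_dualCurvature {r : E4 → E4 → Bil} (h : IsCurvatureTensor r) (u v : E4)
    (k : Fin 3) : minusCoord e (r v u) k = dualCurvature e r (-1) k u v / 2 := by
  have hs : ∀ i j, r v u (e i) (e j) = r (e j) (e i) u v := fun i j => by
    rw [h.pair_symm, altForms_swap (h.alt _ _), h.swap, neg_neg]
  fin_cases k <;> simp [minusCoord, dualCurvature, hs, sub_eq_add_neg]

/-- The entries of the curvature operator in the basis `eᵢ ∧ eⱼ` are symmetric. -/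
theorem IsCurvatureTensor.plus_apply_comm {r : E4 → E4 → Bil} (h : IsCurvatureTensor r)
    (k l : Fin 3) :
    plusCoord e (dualCurvature e r 1 k) l = plusCoord e (dualCurvature e r 1 l) k ∧
      plusCoord e (dualCurvature e r (-1) k) l = minusCoord e (dualCurvature e r 1 l) k := by
  have p : ∀ w z u v, r w z u v = r v u z w := fun w z u v => by
    rw [h.pair_symm, altForms_swap (h.alt _ _), h.swap, neg_neg]
  have p1 := p (e 1) (e 0) (e 0) (e 2)
  have p2 := p (e 1) (e 0) (e 0) (e 3)
  have p3 := p (e 1) (e 0) (e 2) (e 3)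
  have p4 := p (e 1) (e 0) (e 3) (e 1)
  have p5 := p (e 1) (e 0) (e 1) (e 2)
  have p6 := p (e 2) (e 0) (e 0) (e 3)
  have p7 := p (e 2) (e 0) (e 2) (e 3)
  have p8 := p (e 2) (e 0) (e 3) (e 1)
  have p9 := p (e 2) (e 0) (e 1) (e 2)
  have p10 := p (e 3) (e 0) (e 2) (e 3)
  have p11 := p (e 3) (e 0) (e 3) (e 1)
  have p12 := p (e 3) (e 0) (e 1) (e 2)
  have p13 := p (e 3) (e 2) (e 3) (e 1)
  have p14 := p (e 3) (e 2) (e 1) (e 2)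
  have p15 := p (e 1) (e 3) (e 1) (e 2)
  fin_cases k <;> fin_cases l <;> constructor <;> simp [plusCoord, minusCoord, dualCurvature] <;>
    linarith

/-- Pair symmetry identifies both halves of the form `r v u` with values of the curvatures of `Λ⁺`
and `Λ⁻`; this expresses the sectional curvature through the three blocks. -/
theorem sectionalForm_eq {r : E4 → E4 → Bil} (h : IsCurvatureTensor r) {u v : E4}
    {x y : Fin 3 → ℝ}
    (huv : ∀ i j, e.repr u i * e.repr v j - e.repr u j * e.repr v i = skewMat x y i j) :
    r v u u v = 2 * blockForm (Matrix.of fun l k => plusCoord e (dualCurvature e r 1 k) l)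
      (Matrix.of fun k l => minusCoord e (dualCurvature e r 1 k) l)
      (Matrix.of fun l k => minusCoord e (dualCurvature e r (-1) k) l) x y := by
  have hB : ∀ k l, plusCoord e (dualCurvature e r (-1) k) l
      = minusCoord e (dualCurvature e r 1 l) k := fun k l => (h.plus_apply_comm k l).2
  rw [alt_apply_eq (h.alt v u) huv]
  have h1 : plusCoord e (r v u) = fun k => dualCurvature e r 1 k u v / 2 :=
    funext fun k => plusCoord_eq_dualCurvature h u v k
  have h2 : minusCoord e (r v u) = fun k => dualCurvature e r (-1) k u v / 2 :=
    funext fun k => minusCoord_eq_dualCurvature h u v k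
  rw [h1, h2]
  simp only [alt_apply_eq (dualCurvature_mem h _ _) huv, blockForm, dotProduct, mulVec,
    Matrix.of_apply, Fin.sum_univ_three, hB]
  ring

/-- The difference of the traces is a Bianchi sum over four distinct basis vectors. -/
theorem trace_plus_eq_trace_minus {r : E4 → E4 → Bil} (h : IsCurvatureTensor r) :
    (Matrix.of fun l k => plusCoord e (dualCurvature e r 1 k) l).trace
      = (Matrix.of fun l k => minusCoord e (dualCurvature e r (-1) k) l).trace := by
  have b := h.bianchi (e 2) (e 3) (e 1) (e 0)
  have p : ∀ w z u v, r w z u v = r v u z w := fun w z u v => by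
    rw [h.pair_symm, altForms_swap (h.alt _ _), h.swap, neg_neg]
  have p1 := p (e 1) (e 0) (e 2) (e 3)
  have p2 := p (e 2) (e 0) (e 3) (e 1)
  have p3 := p (e 3) (e 0) (e 1) (e 2)
  simp [Matrix.trace, Fin.sum_univ_three, plusCoord, minusCoord, dualCurvature]
  linarith [h.swap (e 0) (e 3) (e 1) (e 2)]

theorem isSymm_plus {r : E4 → E4 → Bil} (h : IsCurvatureTensor r) :
    (Matrix.of fun l k => plusCoord e (dualCurvature e r 1 k) l).IsSymm := by
  ext l k
  exact (h.plus_apply_comm l k).1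

/-- If the sectional curvatures are positive and `2/5`-pinched, then the curvature of `Λ⁺` spans the
self-dual forms of some basis, and reverses orientation. -/
theorem exists_selfDual_frame_dualCurvature {r : E4 → E4 → Bil} (h : IsCurvatureTensor r)
    (hq : ∀ (u v u' v' : E4) (x y x' y' : Fin 3 → ℝ), x ⬝ᵥ x = 1 → y ⬝ᵥ y = 1 →
      x' ⬝ᵥ x' = 1 → y' ⬝ᵥ y' = 1 →
      (∀ i j, e.repr u i * e.repr v j - e.repr u j * e.repr v i = skewMat x y i j) →
      (∀ i j, e.repr u' i * e.repr v' j - e.repr u' j * e.repr v' i = skewMat x' y' i j) →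
      2 * r v' u' u' v' < 5 * r v u u v) :
    ∃ e', Submodule.span ℝ (Set.range (dualCurvature e r 1)) = dualForms e' 1 ∧
      HasFormOrientation e' (dualCurvature e r 1) (-1) := by
  set A := Matrix.of fun l k => plusCoord e (dualCurvature e r 1 k) l
  set B := Matrix.of fun k l => minusCoord e (dualCurvature e r 1 k) l
  set C := Matrix.of fun l k => minusCoord e (dualCurvature e r (-1) k) l
  obtain ⟨hdet, hlt⟩ := posDef_of_pinched (A := A) (B := B) (C := C) (isSymm_plus h)
    (trace_plus_eq_trace_minus h) (by
      intro x y x' y' hx hy hx' hy'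
      obtain ⟨u, v, huv⟩ := exists_decomposition hx hy
      obtain ⟨u', v', huv'⟩ := exists_decomposition hx' hy'
      have hr : ∀ (w : Fin 4 → ℝ) i, e.repr (e.equivFun.symm w) i = w i := fun w i => by
        rw [← Module.Basis.equivFun_apply, LinearEquiv.apply_symm_apply]
      have hr' : ∀ {x y : Fin 3 → ℝ} {u v : Fin 4 → ℝ},
          (∀ i j, u i * v j - u j * v i = skewMat x y i j) → ∀ i j,
            e.repr (e.equivFun.symm u) i * e.repr (e.equivFun.symm v) j
              - e.repr (e.equivFun.symm u) j * e.repr (e.equivFun.symm v) i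
                = skewMat x y i j := fun huv i j => by
        rw [hr, hr, hr, hr, huv]
      have key := hq _ _ _ _ x y x' y' hx hy hx' hy' (hr' huv) (hr' huv')
      rw [sectionalForm_eq h (hr' huv), sectionalForm_eq h (hr' huv')] at key
      linarith)
  -- The combination with coefficients `c` has self-dual part `A c` and anti-self-dual part `Bᵀ c`,
  -- so wedge positivity is `|Bᵀc| < |Ac|`.
  refine exists_selfDual_frame (e := e) (dualCurvature_mem h 1) (fun c hc => ?_) ?_
  · have h1 : plusCoord e (∑ k, c k • dualCurvature e r 1 k) = A *ᵥ c := by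
      ext l
      simp [A, mulVec, dotProduct, mul_comm]
    have h2 : minusCoord e (∑ k, c k • dualCurvature e r 1 k) = c ᵥ* B := by
      ext l
      simp [B, vecMul, dotProduct]
    rw [wedgeForm_apply, h1, h2]
    linarith [hlt c hc]
  · rw [← Matrix.det_transpose]
    exact hdet

end CurvatureTensors

/-! ### The Lie algebra `𝔰𝔬(3)` and curvatures given by three forms. -/

section So3

set_option maxSynthPendingDepth 4

attribute [local instance] LieRing.ofAssociativeRing

open Matrix

/-- The matrix of the cross product with `x`. -/
def crossMat (x : Fin 3 → ℝ) : Matrix (Fin 3) (Fin 3) ℝ :=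
  !![0, -x 2, x 1; x 2, 0, -x 0; -x 1, x 0, 0]

theorem so3_apply_swap (A : so3) (i j : Fin 3) :
    (A : Matrix (Fin 3) (Fin 3) ℝ) j i = -(A : Matrix (Fin 3) (Fin 3) ℝ) i j :=
  congrFun (congrFun ((LieAlgebra.Orthogonal.mem_so _ _ _).1 A.2) i) j

/-- The standard coordinates on `𝔰𝔬(3)`. -/
def so3Equiv : so3 ≃ₗ[ℝ] (Fin 3 → ℝ) where
  toFun A := ![(A : Matrix (Fin 3) (Fin 3) ℝ) 2 1, (A : Matrix (Fin 3) (Fin 3) ℝ) 0 2,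
    (A : Matrix (Fin 3) (Fin 3) ℝ) 1 0]
  map_add' A B := by
    ext i
    fin_cases i <;> simp
  map_smul' c A := by
    ext i
    fin_cases i <;> simp
  invFun x := ⟨crossMat x, (LieAlgebra.Orthogonal.mem_so _ _ _).2 (by
    ext i j
    fin_cases i <;> fin_cases j <;> simp [crossMat])⟩
  left_inv A := by
    have h := so3_apply_swap A
    have h0 := h 0 0
    have h1 := h 1 1
    have h2 := h 2 2
    ext i j
    fin_cases i <;> fin_cases j <;> simp [crossMat] <;>
      linarith [h 0 1, h 0 2, h 1 2]
  right_inv x := by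
    ext i
    fin_cases i <;> simp [crossMat]

theorem coe_so3Equiv_symm (x : Fin 3 → ℝ) :
    (so3Equiv.symm x : Matrix (Fin 3) (Fin 3) ℝ) = crossMat x := rfl

/-- The standard basis of `𝔰𝔬(3)`. -/
def so3Basis : Module.Basis (Fin 3) ℝ so3 := Module.Basis.ofEquivFun so3Equiv

theorem basisSign_so3Basis : basisSign so3Basis = 1 := by
  have h : so3Basis.repr ⁅so3Basis 0, so3Basis 1⁆ 2 = 1 := by
    have h0 : ∀ k, (so3Basis k : Matrix (Fin 3) (Fin 3) ℝ) = crossMat (Pi.single k 1) := by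
      intro k
      rw [so3Basis, Module.Basis.coe_ofEquivFun]
      exact coe_so3Equiv_symm _
    have h1 : so3Basis.repr ⁅so3Basis 0, so3Basis 1⁆ 2
        = (⁅so3Basis 0, so3Basis 1⁆ : so3).1 1 0 := by
      rw [so3Basis, Module.Basis.ofEquivFun_repr_apply]
      rfl
    rw [h1, LieSubalgebra.coe_bracket, Ring.lie_def]
    simp [h0, crossMat]
  rw [basisSign, h, sign_one]

/-- The `𝔰𝔬(3)`-valued 2-form with the given components. -/
def curvatureOfForms (Ω : Fin 3 → Bil) : E4 →ₗ[ℝ] E4 →ₗ[ℝ] so3 :=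
  LinearMap.mk₂ ℝ (fun u v => so3Equiv.symm fun k => Ω k u v)
    (fun u u' v => by rw [← map_add]; congr 1; ext k; simp)
    (fun c u v => by rw [← map_smul]; congr 1; ext k; simp)
    (fun u v v' => by rw [← map_add]; congr 1; ext k; simp)
    (fun c u v => by rw [← map_smul]; congr 1; ext k; simp)

theorem coe_curvatureOfForms (Ω : Fin 3 → Bil) (u v : E4) :
    (curvatureOfForms Ω u v : Matrix (Fin 3) (Fin 3) ℝ) = crossMat fun k => Ω k u v := rfl

theorem curvatureMap_curvatureOfForms (Ω : Fin 3 → Bil) (k : Fin 3) :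
    curvatureMap (curvatureOfForms Ω) (so3Basis.coord k) = Ω k := by
  refine LinearMap.ext₂ fun u v => ?_
  change so3Basis.repr (so3Equiv.symm fun k => Ω k u v) k = _
  rw [so3Basis, Module.Basis.ofEquivFun_repr_apply, LinearEquiv.apply_symm_apply]

theorem range_curvatureMap (Ω : Fin 3 → Bil) :
    LinearMap.range (curvatureMap (curvatureOfForms Ω)) = Submodule.span ℝ (Set.range Ω) := by
  rw [LinearMap.range_eq_map, ← so3Basis.dualBasis.span_eq, Submodule.map_span, ← Set.range_comp]
  congr 2
  ext1 k
  rw [Function.comp_apply, Module.Basis.coe_dualBasis, curvatureMap_curvatureOfForms]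

theorem isDefinite_and_hasSign {Ω : Fin 3 → Bil} {e : Module.Basis (Fin 4) ℝ E4} {s : SignType}
    (hspan : Submodule.span ℝ (Set.range Ω) = dualForms e 1) (hs : HasFormOrientation e Ω s) :
    IsDefinite (curvatureOfForms Ω) ∧ HasSign (curvatureOfForms Ω) s := by
  rw [← range_curvatureMap] at hspan
  refine ⟨?_, e, hspan, so3Basis, basisSign_so3Basis, ?_⟩
  · rw [IsDefinite, hspan]
    exact maximal_dualForms e
  · simpa only [curvatureMap_curvatureOfForms] using hs

theorem span_neg_range (Ω : Fin 3 → Bil) :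
    Submodule.span ℝ (Set.range fun k => -Ω k) = Submodule.span ℝ (Set.range Ω) := by
  rw [← Submodule.span_neg (Set.range Ω)]
  congr 1
  ext α
  simp only [Set.mem_range, Set.mem_neg, eq_comm (b := α), eq_comm (b := -α), neg_eq_iff_eq_neg,
    eq_neg_iff_add_eq_zero]

/-- A linear functional on `𝔰𝔬(3)` that the curvature annihilates prevents it from having a
sign. -/
theorem not_hasSign {F : E4 →ₗ[ℝ] E4 →ₗ[ℝ] so3} {φ : Module.Dual ℝ so3} (hφ : φ ≠ 0)
    (h : ∀ u v, φ (F u v) = 0) (s : SignType) : ¬ HasSign F s := by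
  rintro ⟨e, hrange, -⟩
  have h3 : Module.finrank ℝ (Module.Dual ℝ so3) = 3 := by
    rw [Subspace.dual_finrank_eq, Module.finrank_eq_card_basis so3Basis, Fintype.card_fin]
  have hker : 0 < Module.finrank ℝ (LinearMap.ker (curvatureMap F)) := by
    have : FiniteDimensional ℝ so3 := so3Basis.finiteDimensional_of_finite
    refine Module.finrank_pos_iff_exists_ne_zero.2 ⟨⟨φ, ?_⟩, ?_⟩
    · exact LinearMap.ext₂ h
    · exact fun h0 => hφ (congrArg Subtype.val h0)
  have : FiniteDimensional ℝ so3 := so3Basis.finiteDimensional_of_finite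
  have := LinearMap.finrank_range_add_finrank_ker (curvatureMap F)
  rw [hrange, finrank_dualForms, h3] at this
  omega

end So3

/-! ### Definiteness at a point of a Riemannian metric. -/

section Pointwise

set_option maxSynthPendingDepth 4

open Matrix

variable {G : CoordMetric} {y : E4} {e : Module.Basis (Fin 4) ℝ E4}

/-- The 2-form `(u, v) ↦ τ g(R(u, v)w, z)`. -/
def curvatureForm (G : CoordMetric) (y : E4) (τ : ℝ) (w z : E4) : Bil :=
  LinearMap.mk₂ ℝ (fun u v => τ * G y (riemannMap G y u v w) z)
    (by intros; simp; ring) (by intros; simp; ring) (by intros; simp; ring) (by intros; simp; ring)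

theorem curvatureForm_apply (τ : ℝ) (u v w z : E4) :
    curvatureForm G y τ w z u v = τ * G y (riemannMap G y u v w) z := rfl

theorem RegularMetricAt.isCurvatureTensor (h : RegularMetricAt G y) (τ : ℝ) :
    IsCurvatureTensor (curvatureForm G y τ) where
  alt w z v := by
    have := RegularMetricAt.riemannMap_swap G y v v w
    have h0 : G y (riemannMap G y v v w) z = -G y (riemannMap G y v v w) z := by
      conv_lhs => rw [this]
      simp
    rw [curvatureForm_apply, self_eq_neg.1 h0, mul_zero]
  swap w z u v := by
    rw [curvatureForm_apply, curvatureForm_apply, h.inner_riemannMap_swap]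
    ring
  bianchi u v w z := by
    simp only [curvatureForm_apply]
    rw [← mul_add, ← mul_add, ← _root_.add_apply, ← _root_.add_apply,
      ← map_add, ← map_add, h.bianchi, map_zero, _root_.zero_apply, mul_zero]

theorem repr_eq (he : ∀ i j, G y (e i) (e j) = if i = j then 1 else 0) (w : E4)
    (i : Fin 4) :
    e.repr w i = G y w (e i) := by
  conv_rhs => rw [← e.sum_repr w]
  simp [he, -Module.Basis.sum_repr]

theorem metric_eq_sum (he : ∀ i j, G y (e i) (e j) = if i = j then 1 else 0) (v w : E4) :
    G y v w = ∑ i, e.repr v i * e.repr w i := by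
  conv_lhs => rw [← e.sum_repr v, ← e.sum_repr w]
  simp [he, -Module.Basis.sum_repr, mul_comm]

/-- The minus sign in front of `dualCurvature` offsets the orientation `-1` from
`exists_selfDual_frame`, so positive curvature gets the sign `1`. -/
theorem formCurvature_dualFrame (h : RegularMetricAt G y)
    (he : ∀ i j, G y (e i) (e j) = if i = j then 1 else 0) (u v : E4) (j : Fin 3) (a b : E4) :
    formCurvature G y u v (dualFrame e 1 j) a b
      = ∑ i, (curvatureOfForms (fun k => -dualCurvature e (curvatureForm G y 1) 1 k) u v :
          Matrix (Fin 3) (Fin 3) ℝ) i j * dualFrame e 1 i a b := by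
  have hR : ∀ a k, e.repr (riemannMap G y u v a) k
      = ∑ i, e.repr a i * curvatureForm G y 1 (e i) (e k) u v := fun a k => by
    rw [repr_eq he]
    conv_lhs => rw [← e.sum_repr a]
    simp [curvatureForm_apply, -Module.Basis.sum_repr]
  have hC := h.isCurvatureTensor 1
  have hd : ∀ i, curvatureForm G y 1 (e i) (e i) u v = 0 := fun i => by
    linarith [hC.swap (e i) (e i) u v]
  rw [h.formCurvature_eq, coe_curvatureOfForms]
  fin_cases j <;>
    simp [dualFrame, wedgeCovectors, crossMat, dualCurvature, Fin.sum_univ_three, hR,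
      Fin.sum_univ_four, hd, hC.swap (e 0) (e 1), hC.swap (e 0) (e 2), hC.swap (e 0) (e 3),
      hC.swap (e 1) (e 2), hC.swap (e 2) (e 3), hC.swap (e 3) (e 1)] <;> ring

/-- By Lagrange's identity the squared area is the sum of the squares of the Plücker coordinates,
here `2|x|² + 2|z|²`. -/
theorem area_eq (he : ∀ i j, G y (e i) (e j) = if i = j then 1 else 0) {u v : E4}
    {x z : Fin 3 → ℝ} (hx : x ⬝ᵥ x = 1) (hz : z ⬝ᵥ z = 1)
    (huv : ∀ i j, e.repr u i * e.repr v j - e.repr u j * e.repr v i = skewMat x z i j) :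
    G y u u * G y v v - G y u v ^ 2 = 4 := by
  simp only [metric_eq_sum he, Fin.sum_univ_four]
  have h01 := huv 0 1
  have h02 := huv 0 2
  have h03 := huv 0 3
  have h12 := huv 1 2
  have h31 := huv 3 1
  have h23 := huv 2 3
  simp [skewMat] at h01 h02 h03 h12 h31 h23
  simp only [dotProduct, Fin.sum_univ_three] at hx hz
  have key : ∀ a b : ℝ, a = b → a ^ 2 = b ^ 2 := fun a b h => h ▸ rfl
  linear_combination key _ _ h01 + key _ _ h02 + key _ _ h03 + key _ _ h12 + key _ _ h31
    + key _ _ h23 + 2 * hx + 2 * hz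

theorem linearIndependent_of_area (hsymm : ∀ v w, G y v w = G y w v) {u v : E4}
    (h : G y u u * G y v v - G y u v ^ 2 ≠ 0) : LinearIndependent ℝ ![u, v] := by
  rw [LinearIndependent.pair_iff]
  intro s t hst
  have h1 : s * G y u u + t * G y u v = 0 := by
    simpa [hsymm v u] using congrArg (G y u) hst
  have h2 : s * G y u v + t * G y v v = 0 := by
    simpa [hsymm v u] using congrArg (G y v) hst
  constructor
  · refine (mul_eq_zero.1 (?_ : s * (G y u u * G y v v - G y u v ^ 2) = 0)).resolve_right h
    linear_combination G y v v * h1 - G y u v * h2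
  · refine (mul_eq_zero.1 (?_ : t * (G y u u * G y v v - G y u v ^ 2) = 0)).resolve_right h
    linear_combination G y u u * h2 - G y u v * h1

/-- The factor `τ` makes all sectional curvatures positive and leaves their ratios unchanged, so one
argument serves both signs. -/
theorem exists_selfDual_frame_of_pinched (h : RegularMetricAt G y)
    (he : ∀ i j, G y (e i) (e j) = if i = j then 1 else 0) {τ : ℝ}
    (hsec : ∀ u v, LinearIndependent ℝ ![u, v] → 0 < τ * sectional G y u v)
    (hpinch : ∀ u v u' v', LinearIndependent ℝ ![u, v] → LinearIndependent ℝ ![u', v'] →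
      2 / 5 < sectional G y u v / sectional G y u' v') :
    ∃ e', Submodule.span ℝ (Set.range (dualCurvature e (curvatureForm G y τ) 1)) = dualForms e' 1 ∧
      HasFormOrientation e' (dualCurvature e (curvatureForm G y τ) 1) (-1) := by
  refine exists_selfDual_frame_dualCurvature (h.isCurvatureTensor τ) ?_
  intro u v u' v' x z x' z' hx hz hx' hz' huv huv'
  have hs := h.symm.self_of_nhds
  have ha := area_eq he hx hz huv
  have ha' := area_eq he hx' hz' huv'
  have hl := linearIndependent_of_area hs (by rw [ha]; norm_num : _ ≠ (0 : ℝ))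
  have hl' := linearIndependent_of_area hs (by rw [ha']; norm_num : _ ≠ (0 : ℝ))
  have h1 : ∀ {u v}, G y u u * G y v v - G y u v ^ 2 = 4 →
      curvatureForm G y τ v u u v = 4 * (τ * sectional G y u v) := fun {u v} ha => by
    rw [curvatureForm_apply, sectional, ha, h.riemann_eq]
    ring
  rw [h1 ha, h1 ha']
  have hp := hpinch u v u' v' hl hl'
  have hτ : τ ≠ 0 := by
    rintro rfl
    simpa using hsec u v hl
  rw [← mul_div_mul_left (sectional G y u v) _ hτ, lt_div_iff₀ (hsec _ _ hl')] at hp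
  linarith

/-- At a point where the sectional curvatures are positive and `2/5`-pinched, the curvature of
the bundle of self-dual forms is positive definite. -/
theorem exists_positive_definite_curvature (h : RegularMetricAt G y)
    (he : ∀ i j, G y (e i) (e j) = if i = j then 1 else 0)
    (hsec : ∀ u v, LinearIndependent ℝ ![u, v] → 0 < sectional G y u v)
    (hpinch : ∀ u v u' v', LinearIndependent ℝ ![u, v] → LinearIndependent ℝ ![u', v'] →
      2 / 5 < sectional G y u v / sectional G y u' v') :
    ∃ F : E4 →ₗ[ℝ] E4 →ₗ[ℝ] so3, (∀ u v j a b, formCurvature G y u v (dualFrame e 1 j) a b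
      = ∑ i, (F u v : Matrix (Fin 3) (Fin 3) ℝ) i j * dualFrame e 1 i a b) ∧
      IsDefinite F ∧ HasSign F 1 := by
  obtain ⟨e', hspan, hor⟩ := exists_selfDual_frame_of_pinched (τ := 1) h he
    (by simpa using hsec) hpinch
  refine ⟨_, formCurvature_dualFrame h he, isDefinite_and_hasSign (e := e') ?_ ?_⟩
  · rw [span_neg_range, hspan]
  · simpa using hor.neg

/-- At a point where the sectional curvatures are negative and `2/5`-pinched, the curvature of
the bundle of self-dual forms is negative definite. -/
theorem exists_negative_definite_curvature (h : RegularMetricAt G y)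
    (he : ∀ i j, G y (e i) (e j) = if i = j then 1 else 0)
    (hsec : ∀ u v, LinearIndependent ℝ ![u, v] → sectional G y u v < 0)
    (hpinch : ∀ u v u' v', LinearIndependent ℝ ![u, v] → LinearIndependent ℝ ![u', v'] →
      2 / 5 < sectional G y u v / sectional G y u' v') :
    ∃ F : E4 →ₗ[ℝ] E4 →ₗ[ℝ] so3, (∀ u v j a b, formCurvature G y u v (dualFrame e 1 j) a b
      = ∑ i, (F u v : Matrix (Fin 3) (Fin 3) ℝ) i j * dualFrame e 1 i a b) ∧
      IsDefinite F ∧ HasSign F (-1) := by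
  obtain ⟨e', hspan, hor⟩ := exists_selfDual_frame_of_pinched (τ := -1) h he
    (by simpa using hsec) hpinch
  have hneg : dualCurvature e (curvatureForm G y (-1)) 1
      = fun k => -dualCurvature e (curvatureForm G y 1) 1 k := by
    ext k u v
    fin_cases k <;> simp [dualCurvature, curvatureForm_apply] <;> ring
  rw [hneg] at hspan hor
  exact ⟨_, formCurvature_dualFrame h he, isDefinite_and_hasSign hspan hor⟩

end Pointwise

/-! ### Reversal of orientation exchanges `Λ⁺` and `Λ⁻`. -/

section Reversal

variable {e : Module.Basis (Fin 4) ℝ E4}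

/-- The basis `(-e₀, e₁, e₂, e₃)`. -/
def reverseBasis (e : Module.Basis (Fin 4) ℝ E4) : Module.Basis (Fin 4) ℝ E4 :=
  e.unitsSMul ![-1, 1, 1, 1]

/-- The common sign `-1` is harmless: the curvature matrix in a frame does not change when the whole
frame is negated. -/
theorem dualFrame_reverseBasis (j : Fin 3) :
    dualFrame (reverseBasis e) 1 j = -dualFrame e (-1) j := by
  have h : ∀ i v, (reverseBasis e).coord i v = (![-1, 1, 1, 1] : Fin 4 → ℝ) i * e.coord i v := by
    intro i v
    rw [reverseBasis, Module.Basis.coord_unitsSMul]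
    fin_cases i <;> simp
  refine LinearMap.ext₂ fun u v => ?_
  fin_cases j <;> simp [dualFrame, wedgeCovectors, h] <;> ring

theorem reverseBasis_orthonormal {G : CoordMetric} {y : E4}
    (he : ∀ i j, G y (e i) (e j) = if i = j then 1 else 0) (i j : Fin 4) :
    G y (reverseBasis e i) (reverseBasis e j) = if i = j then 1 else 0 := by
  simp only [reverseBasis, Module.Basis.unitsSMul_apply]
  fin_cases i <;> fin_cases j <;> simp [he]

end Reversal

/-! ### The theorem for pinched manifolds. -/

section Pinching

variable {X : Type*} [TopologicalSpace X] [ChartedSpace E4 X] [IsManifold (𝓡 4) ∞ X]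

/-- The hypothesis concerns orthonormal bases of either orientation; applied to the reversed basis
it yields the statement for `Λ⁻`. -/
theorem inducesDefinite_of_forall {g : RMetric X} {o : ManifoldOrientation X} {s : SignType}
    (h : ∀ x (e : Module.Basis (Fin 4) ℝ E4),
      (∀ i j, coordMetric g x (extChartAt (𝓡 4) x x) (e i) (e j) = if i = j then 1 else 0) →
      ∃ F : E4 →ₗ[ℝ] E4 →ₗ[ℝ] so3, IsCurvatureOnDual g x e 1 F ∧ IsDefinite F ∧ HasSign F s) :
    InducesDefinite g o 1 s ∧ InducesDefinite g o (-1) s := by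
  refine ⟨fun x e he => h x e he.1, fun x e he => ?_⟩
  obtain ⟨F, hF, hdef⟩ := h x (reverseBasis e) (reverseBasis_orthonormal he.1)
  refine ⟨F, fun u v j a b => ?_, hdef⟩
  have hreg := regularMetricAt_coordMetric g x
  have := hF u v j a b
  simp only [hreg.formCurvature_eq, dualFrame_reverseBasis, LinearMap.neg_apply, mul_neg,
    Finset.sum_neg_distrib] at this ⊢
  linarith

theorem inducesPositiveDefinite_of_pinched {g : RMetric X} (o : ManifoldOrientation X)
    (hpos : PositiveCurvature g) (hpinch : IsPinched g (2 / 5)) : InducesPositiveDefinite g o :=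
  inducesDefinite_of_forall fun x _ he =>
    exists_positive_definite_curvature (regularMetricAt_coordMetric g x) he (hpos x) (hpinch x)

theorem inducesNegativeDefinite_of_pinched {g : RMetric X} (o : ManifoldOrientation X)
    (hneg : NegativeCurvature g) (hpinch : IsPinched g (2 / 5)) : InducesNegativeDefinite g o :=
  inducesDefinite_of_forall fun x _ he =>
    exists_negative_definite_curvature (regularMetricAt_coordMetric g x) he (hneg x) (hpinch x)

end Pinching

/-! ### The ball in `ℝ⁴` as an oriented Riemannian manifold. -/

section BallManifold

/-- The open ball of radius `ρ` in `ℝ⁴`. -/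
def BallE4 (ρ : ℝ) : Type := Metric.ball (0 : E4) ρ

variable {ρ : ℝ}

instance : TopologicalSpace (BallE4 ρ) :=
  inferInstanceAs (TopologicalSpace (Metric.ball (0 : E4) ρ))

instance : T2Space (BallE4 ρ) := inferInstanceAs (T2Space (Metric.ball (0 : E4) ρ))

instance : SecondCountableTopology (BallE4 ρ) :=
  inferInstanceAs (SecondCountableTopology (Metric.ball (0 : E4) ρ))

/-- The inclusion of the ball. -/
def BallE4.val (x : BallE4 ρ) : E4 := Subtype.val x

theorem isOpenEmbedding_ballVal : Topology.IsOpenEmbedding (BallE4.val : BallE4 ρ → E4) :=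
  Metric.isOpen_ball.isOpenEmbedding_subtypeVal

theorem BallE4.val_mem (x : BallE4 ρ) : x.val ∈ Metric.ball (0 : E4) ρ := Subtype.property x

variable [hρ : Fact (0 < ρ)]

/-- The centre of the ball. -/
def BallE4.center : BallE4 ρ := ⟨0, Metric.mem_ball_self hρ.out⟩

instance : Nonempty (BallE4 ρ) := ⟨BallE4.center⟩

instance : ChartedSpace E4 (BallE4 ρ) := isOpenEmbedding_ballVal.singletonChartedSpace

instance : IsManifold (𝓡 4) ∞ (BallE4 ρ) := isOpenEmbedding_ballVal.isManifold_singleton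

theorem contMDiff_ballVal : ContMDiff (𝓡 4) 𝓘(ℝ, E4) ∞ (BallE4.val : BallE4 ρ → E4) :=
  contMDiff_isOpenEmbedding isOpenEmbedding_ballVal

theorem extChartAt_ball (x y : BallE4 ρ) : extChartAt (𝓡 4) x y = y.val := rfl

theorem extChartAt_ball_target (x : BallE4 ρ) :
    (extChartAt (𝓡 4) x).target = Metric.ball 0 ρ := by
  rw [← (extChartAt (𝓡 4) x).image_source_eq_target, extChartAt_source]
  change BallE4.val '' Set.univ = _
  rw [Set.image_univ]
  exact Subtype.range_val

theorem extChartAt_ball_symm (x : BallE4 ρ) {y : E4} (hy : y ∈ Metric.ball 0 ρ) :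
    ((extChartAt (𝓡 4) x).symm y).val = y := by
  rw [← extChartAt_ball x]
  exact (extChartAt (𝓡 4) x).right_inv (by rwa [extChartAt_ball_target])

/-- All preferred charts are the inclusion, so every coordinate change is the identity. -/
theorem symmL_trivializationAt_ball (x b : BallE4 ρ) (v : E4) :
    (trivializationAt E4 (TangentSpace (𝓡 4)) x).symmL ℝ b v = v := by
  have hb : b ∈ (chartAt E4 x).source := mem_chart_source E4 b
  rw [TangentBundle.symmL_trivializationAt_eq_core hb]
  exact (tangentBundleCore (𝓡 4) (BallE4 ρ)).coordChange_self (achart E4 b) b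
    (mem_chart_source E4 b) v

theorem chartDifferential_ball (x : BallE4 ρ) {y : E4} (hy : y ∈ Metric.ball 0 ρ) :
    chartDifferential x y = ContinuousLinearMap.id ℝ E4 := by
  ext1 v
  rw [chartDifferential_eq_symmL (by rwa [extChartAt_ball_target])]
  exact symmL_trivializationAt_ball _ _ _

/-- The standard orientation of the ball. -/
def ballOrientation : ManifoldOrientation (BallE4 ρ) where
  at_point _ := (EuclideanSpace.basisFun (Fin 4) ℝ).toBasis.orientation
  locally_constant x := by
    filter_upwards [extChartAt_target_mem_nhds x] with y hy b b' hb
    rw [extChartAt_ball_target] at hy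
    have hbb : ∀ i, (b' i : E4) = b i := fun i => by
      rw [hb i, chartDifferential_ball x hy]
      rfl
    have : (b' : Module.Basis (Fin 4) ℝ E4) = b := Module.Basis.eq_of_apply_eq hbb
    change (b' : Module.Basis (Fin 4) ℝ E4).orientation = _ ↔ _
    rw [this]
    rfl

/-- The bilinear form `G` on the tangent spaces of the ball. -/
def ballInner (G : CoordMetric) (x : BallE4 ρ) :
    TangentSpace (𝓡 4) x →L[ℝ] TangentSpace (𝓡 4) x →L[ℝ] ℝ :=
  (G x.val : E4 →L[ℝ] E4 →L[ℝ] ℝ)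

theorem contMDiff_ballInner {G : CoordMetric} (hG : ContDiff ℝ ∞ G) :
    ContMDiff (𝓡 4) ((𝓡 4).prod 𝓘(ℝ, E4 →L[ℝ] E4 →L[ℝ] ℝ)) ∞
      (fun b : BallE4 ρ => Bundle.TotalSpace.mk' (E4 →L[ℝ] E4 →L[ℝ] ℝ) b (ballInner G b)) := by
  intro x
  rw [Bundle.contMDiffAt_section]
  have h : ContMDiff (𝓡 4) 𝓘(ℝ, E4 →L[ℝ] E4 →L[ℝ] ℝ) ∞ fun b : BallE4 ρ => G b.val :=
    hG.contMDiff.comp contMDiff_ballVal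
  convert! h.contMDiffAt (x := x) using 1
  ext b v w
  simp [hom_trivializationAt_apply, ContinuousLinearMap.inCoordinates]
  have hs : ∀ v : E4, (trivializationAt E4 (TangentSpace (𝓡 4)) x).symm b v = v := fun v => by
    have hb : b ∈ (trivializationAt E4 (TangentSpace (𝓡 4)) x).baseSet := mem_chart_source E4 b
    rw [← Bundle.Trivialization.symmL_apply (R := ℝ) _ hb]
    exact symmL_trivializationAt_ball _ _ _
  rw [hs, hs]
  rfl

/-- The Riemannian metric on the ball with the given coefficients. -/
def ballMetric (G : CoordMetric) (hG : ContDiff ℝ ∞ G) (hsymm : ∀ y v w, G y v w = G y w v)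
    (hpos : ∀ y ∈ Metric.ball (0 : E4) ρ, ∀ v, ‖v‖ ^ 2 / 2 ≤ G y v v) : RMetric (BallE4 ρ) where
  inner := ballInner G
  symm x := hsymm x.val
  pos x (v : E4) hv := by
    have h1 := hpos x.val x.val_mem v
    have h2 : 0 < ‖(v : E4)‖ ^ 2 := by
      have : 0 < ‖(v : E4)‖ := norm_pos_iff.2 hv
      positivity
    change 0 < G x.val v v
    linarith
  isVonNBounded x := by
    change Bornology.IsVonNBounded ℝ {v : E4 | G x.val v v < 1}
    -- The lower bound `‖v‖²/2` puts the unit ball of `G` inside `‖v‖² < 2`, hence in the ball of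
    -- radius 2.
    refine (NormedSpace.isVonNBounded_ball ℝ E4 2).subset fun v hv => ?_
    have h1 := hpos x.val x.val_mem v
    have h2 : G x.val v v < 1 := hv
    rw [mem_ball_zero_iff]
    nlinarith [norm_nonneg v]
  contMDiff := contMDiff_ballInner hG

theorem coordMetric_ballMetric {G : CoordMetric} {hG : ContDiff ℝ ∞ G}
    {hsymm : ∀ y v w, G y v w = G y w v}
    {hpos : ∀ y ∈ Metric.ball (0 : E4) ρ, ∀ v, ‖v‖ ^ 2 / 2 ≤ G y v v} (x : BallE4 ρ) {y : E4}
    (hy : y ∈ Metric.ball 0 ρ) : coordMetric (ballMetric G hG hsymm hpos) x y = G y := by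
  ext v w
  have hD : ∀ v, chartDifferential x y v = v := fun v => by
    rw [chartDifferential_ball x hy]
    rfl
  have h1 : coordMetric (ballMetric G hG hsymm hpos) x y v w
      = G ((extChartAt (𝓡 4) x).symm y).val (chartDifferential x y v)
        (chartDifferential x y w) := rfl
  rw [h1, hD, hD, extChartAt_ball_symm x hy]

end BallManifold

/-! ### Curvature depends only on the germ of the metric. -/

section Germs

variable {G G' : CoordMetric} {y : E4}

theorem christoffelMap_congr (h : G =ᶠ[𝓝 y] G') : christoffelMap G y = christoffelMap G' y := by
  rw [christoffelMap, christoffelMap, christoffelForm, christoffelForm, h.fderiv_eq, h.eq_of_nhds]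

theorem riemannMap_congr (h : G =ᶠ[𝓝 y] G') : riemannMap G y = riemannMap G' y := by
  have h1 : christoffelMap G =ᶠ[𝓝 y] christoffelMap G' :=
    h.eventuallyEq_nhds.mono fun _ hz => christoffelMap_congr hz
  rw [riemannMap, riemannMap, secondNabla, secondNabla, h1.fderiv_eq, h1.eq_of_nhds]

theorem sectional_congr (h : G =ᶠ[𝓝 y] G') (hG : RegularMetricAt G y)
    (hG' : RegularMetricAt G' y) (u v : E4) : sectional G y u v = sectional G' y u v := by
  rw [sectional, sectional, hG.riemann_eq, hG'.riemann_eq, riemannMap_congr h, h.eq_of_nhds]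

end Germs

/-! ### Curvature at the origin from the second-order jet. -/

section QuadraticMetric

set_option maxSynthPendingDepth 4

open ContinuousLinearMap

/-- The Euclidean inner product. -/
def euclideanForm : E4 →L[ℝ] E4 →L[ℝ] ℝ := innerSL ℝ

theorem euclideanForm_apply (v w : E4) : euclideanForm v w = inner ℝ v w := rfl

/-- The metric whose coefficients are those of the Euclidean metric plus a quadratic term. -/
def quadraticMetric (H : E4 →L[ℝ] E4 →L[ℝ] E4 →L[ℝ] E4 →L[ℝ] ℝ) : CoordMetric :=
  fun y => euclideanForm + H y y

variable {H : E4 →L[ℝ] E4 →L[ℝ] E4 →L[ℝ] E4 →L[ℝ] ℝ}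

theorem quadraticMetric_zero : quadraticMetric H 0 = euclideanForm := by
  simp [quadraticMetric]

theorem contDiff_quadraticMetric : ContDiff ℝ ∞ (quadraticMetric H) :=
  contDiff_const.add (H.contDiff.clm_apply contDiff_id)

theorem fderiv_quadraticMetric (hH : ∀ u v, H u v = H v u) :
    fderiv ℝ (quadraticMetric H) = (2 : ℝ) • H := by
  funext z
  have h : HasFDerivAt (fun y => H y y) _ z := H.hasFDerivAt.clm_apply (hasFDerivAt_id z)
  have h2 : HasFDerivAt (quadraticMetric H) _ z := h.const_add _
  rw [h2.fderiv]
  ext1 u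
  simp [hH u z, two_smul]

theorem regularMetricAt_quadraticMetric (hs : ∀ u v w z, H u v w z = H u v z w) :
    RegularMetricAt (quadraticMetric H) 0 where
  contDiffAt := contDiff_quadraticMetric.contDiffAt
  symm := Filter.Eventually.of_forall fun y v w => by
    simp [quadraticMetric, hs y y v w, euclideanForm_apply, real_inner_comm]
  pos v hv := by
    rw [quadraticMetric_zero]
    exact real_inner_self_pos.2 hv

/-- The curvature at the origin of a metric with quadratic coefficients. -/
theorem inner_riemannMap_quadraticMetric (hH : ∀ u v, H u v = H v u)
    (hs : ∀ u v w z, H u v w z = H u v z w) (u v w x : E4) :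
    quadraticMetric H 0 (riemannMap (quadraticMetric H) 0 u v w) x
      = H u w v x - H u x v w - H v w u x + H v x u w := by
  have hreg := regularMetricAt_quadraticMetric hs
  set G := quadraticMetric H with hG
  have hlow : ∀ z v w x, christoffelLower G z v w x = H z v w x + H z w v x - H z x v w := by
    intro z v w x
    simp [christoffelLower, fderiv_quadraticMetric hH, hG, hH z]
    ring
  have hspec := hreg.eventually_christoffel_spec
  -- The derivative of the coefficients is linear in the point, so `Γ` vanishes at the origin and
  -- only its derivative enters the curvature.
  have hΓ : christoffelMap G 0 = 0 := by
    obtain ⟨e, he⟩ := hreg.isInvertible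
    ext1 v
    ext1 w
    have h1 := hspec.self_of_nhds v w
    have h2 : christoffelLower G 0 v w = 0 := by
      ext x
      simp [hlow]
    rw [h2, ← he] at h1
    simpa using h1
  have hd : ∀ u v w x, G 0 (fderiv ℝ (christoffelMap G) 0 u v w) x
      = H u v w x + H u w v x - H u x v w := by
    intro u v w x
    have h1 : (fun z => G z (christoffelMap G z v w) x) =ᶠ[𝓝 0]
        fun z => H z v w x + H z w v x - H z x v w := by
      filter_upwards [hspec] with z hz
      rw [hz, hlow]
    have h2 := ((hreg.eventually_differentiableAt.self_of_nhds.hasFDerivAt.clm_apply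
      (hreg.hasFDerivAt_christoffelMap v w)).clm_apply (hasFDerivAt_const x 0))
    have h3 : HasFDerivAt (fun z => H z v w x + H z w v x - H z x v w)
        (((H.flip v).flip w).flip x + ((H.flip w).flip v).flip x - ((H.flip x).flip v).flip w) 0 :=
      (((H.flip v).flip w).flip x + ((H.flip w).flip v).flip x
        - ((H.flip x).flip v).flip w).hasFDerivAt
    have h4 := congrArg (fun L => L u) (h1.fderiv_eq.symm.trans h2.fderiv)
    rw [h3.fderiv] at h4
    simp [hΓ] at h4
    exact h4.symm
  rw [riemannMap_apply, secondNabla_apply, secondNabla_apply, hΓ]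
  simp only [map_sub, _root_.zero_apply, map_zero, add_zero, _root_.sub_apply, hd]
  rw [hH u v]
  ring

end QuadraticMetric
-- The borderline curvature tensor.
section Example
open ContinuousLinearMap
set_option maxSynthPendingDepth 4

/-- The 2-form `e⁰ ∧ e¹ + e² ∧ e³`. -/
def kahlerForm : E4 →L[ℝ] E4 →L[ℝ] ℝ :=
  (EuclideanSpace.proj 0).smulRight (EuclideanSpace.proj 1 : E4 →L[ℝ] ℝ)
    - (EuclideanSpace.proj 1).smulRight (EuclideanSpace.proj 0 : E4 →L[ℝ] ℝ)
    + (EuclideanSpace.proj 2).smulRight (EuclideanSpace.proj 3 : E4 →L[ℝ] ℝ)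
    - (EuclideanSpace.proj 3).smulRight (EuclideanSpace.proj 2 : E4 →L[ℝ] ℝ)

theorem kahlerForm_apply (u v : E4) :
    kahlerForm u v = u 0 * v 1 - u 1 * v 0 + u 2 * v 3 - u 3 * v 2 := by
  simp [kahlerForm]

/-- The second-order coefficients at the origin of the metric of the example. -/
def exampleJet (τ : ℝ) : E4 →L[ℝ] E4 →L[ℝ] E4 →L[ℝ] E4 →L[ℝ] ℝ :=
  LinearMap.toContinuousLinearMap (LinearMap.toContinuousLinearMap.toLinearMap ∘ₗ LinearMap.mk₂ ℝ
    -- The first term contributes constant curvature `5τ/2`; the second subtracts `3τ/2` times the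
    -- square of the Kähler form, which acts only on one direction of `Λ⁺`.
    (fun y y' : E4 => (-(5 / 4) * τ * inner ℝ y y') • euclideanForm
      + (τ / 4) • ((kahlerForm y).smulRight (kahlerForm y')
        + (kahlerForm y').smulRight (kahlerForm y)))
    (by intros; ext; simp [inner_add_left]; ring)
    (by intros; ext; simp [inner_smul_left]; ring)
    (by intros; ext; simp [inner_add_right]; ring)
    (by intros; ext; simp [inner_smul_right]; ring))

theorem exampleJet_apply (τ : ℝ) (y y' v w : E4) : exampleJet τ y y' v w =
    -(5 / 4) * τ * inner ℝ y y' * inner ℝ v w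
      + τ / 4 * (kahlerForm y v * kahlerForm y' w + kahlerForm y' v * kahlerForm y w) := by
  rfl

theorem exampleJet_comm (τ : ℝ) (u v : E4) : exampleJet τ u v = exampleJet τ v u := by
  ext w z
  rw [exampleJet_apply, exampleJet_apply, real_inner_comm]
  ring

theorem exampleJet_symm (τ : ℝ) (u v w z : E4) : exampleJet τ u v w z = exampleJet τ u v z w := by
  rw [exampleJet_apply, exampleJet_apply, real_inner_comm w]
  ring

/-- The metric of the example. -/
abbrev exampleMetric (τ : ℝ) : CoordMetric := quadraticMetric (exampleJet τ)

theorem exampleMetric_zero (τ : ℝ) : exampleMetric τ 0 = euclideanForm := quadraticMetric_zero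

theorem inner_eq_sum (u v : E4) :
    inner ℝ u v = u 0 * v 0 + u 1 * v 1 + u 2 * v 2 + u 3 * v 3 := by
  simp [PiLp.inner_apply, Fin.sum_univ_four]
  ring

/-- On an orthonormal pair this is `τ (5/2 - 3/2 ω(u, v)²)` with `0 ≤ ω² ≤ 1`, so `τ sec` lies
between `1` and `5/2`: the source of the ratio `2/5`. -/
theorem sectional_exampleMetric (τ : ℝ) (u v : E4) :
    sectional (exampleMetric τ) 0 u v = τ * (5 / 2 * (inner ℝ u u * inner ℝ v v - inner ℝ u v ^ 2)
      - 3 / 2 * kahlerForm u v ^ 2) / (inner ℝ u u * inner ℝ v v - inner ℝ u v ^ 2) := by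
  rw [sectional, (regularMetricAt_quadraticMetric (exampleJet_symm τ)).riemann_eq,
    inner_riemannMap_quadraticMetric (exampleJet_comm τ) (exampleJet_symm τ),
    exampleMetric_zero]
  simp only [exampleJet_apply, euclideanForm_apply]
  congr 1
  simp only [inner_eq_sum, kahlerForm_apply]
  ring

/-- Wirtinger's inequality: by the Plücker relation the difference is the sum of the two squares
supplied to `nlinarith`. -/
theorem kahlerForm_sq_le (u v : E4) :
    kahlerForm u v ^ 2 ≤ inner ℝ u u * inner ℝ v v - inner ℝ u v ^ 2 := by
  simp only [inner_eq_sum, kahlerForm_apply]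
  nlinarith [sq_nonneg ((u 0 * v 2 - u 2 * v 0) - (u 1 * v 3 - u 3 * v 1)),
    sq_nonneg ((u 0 * v 3 - u 3 * v 0) + (u 1 * v 2 - u 2 * v 1))]

/-- A component of the curvature of `Λ⁺` vanishes at the origin. -/
theorem dualCurvature_exampleMetric (τ : ℝ) (u v : E4) :
    dualCurvature (EuclideanSpace.basisFun (Fin 4) ℝ).toBasis
      (curvatureForm (exampleMetric τ) 0 1) 1 0 u v = 0 := by
  simp only [dualCurvature, Matrix.cons_val_zero, LinearMap.add_apply, one_smul,
    curvatureForm_apply, inner_riemannMap_quadraticMetric (exampleJet_comm τ) (exampleJet_symm τ),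
    exampleJet_apply]
  simp only [inner_eq_sum, kahlerForm_apply]
  simp
  ring

end Example

/-! ### Continuity of sectional curvature on a compact set of planes. -/

section SectionalCurvature

set_option maxSynthPendingDepth 4

variable {G : CoordMetric} {y : E4}

theorem regularMetricAt_of_contDiff (hG : ContDiff ℝ ∞ G) (hs : ∀ z v w, G z v w = G z w v)
    (hpos : ∀ v ≠ 0, 0 < G y v v) : RegularMetricAt G y :=
  ⟨hG.contDiffAt, Filter.Eventually.of_forall hs, hpos⟩

/-- The sectional curvature depends only on the plane. -/
theorem RegularMetricAt.sectional_triangular (h : RegularMetricAt G y) {a b c : ℝ} (ha : a ≠ 0)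
    (hc : c ≠ 0) (u v : E4) :
    sectional G y (a • u) (b • u + c • v) = sectional G y u v := by
  have hT := h.isCurvatureTensor 1
  have h1 : ∀ u v, G y (riemannMap G y u v v) u = curvatureForm G y 1 v u u v := fun u v => by
    rw [curvatureForm_apply, one_mul]
  have h2 : ∀ w, curvatureForm G y 1 w w u v = 0 := fun w => by
    linarith [hT.swap w w u v]
  have h3 : curvatureForm G y 1 (b • u + c • v) (a • u) (a • u) (b • u + c • v)
      = (a * c) ^ 2 * curvatureForm G y 1 v u u v := by
    have e1 : curvatureForm G y 1 (b • u + c • v) (a • u) (a • u) (b • u + c • v)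
        = b * a * curvatureForm G y 1 u u (a • u) (b • u + c • v)
          + c * a * curvatureForm G y 1 v u (a • u) (b • u + c • v) := by
      simp [curvatureForm_apply]
      ring
    have e2 : curvatureForm G y 1 u u (a • u) (b • u + c • v) = 0 := by
      linarith [hT.swap u u (a • u) (b • u + c • v)]
    have e3 : curvatureForm G y 1 v u u u = 0 := hT.alt v u u
    rw [e1, e2, map_smul, map_add, map_smul, map_smul]
    simp only [LinearMap.smul_apply, e3, smul_eq_mul]
    ring
  have h4 : G y (a • u) (a • u) * G y (b • u + c • v) (b • u + c • v)
      - G y (a • u) (b • u + c • v) ^ 2 = (a * c) ^ 2 * (G y u u * G y v v - G y u v ^ 2) := by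
    simp [h.symm.self_of_nhds v u]
    ring
  rw [sectional, sectional, h.riemann_eq, h.riemann_eq, h1, h1, h3, h4,
    mul_div_mul_left _ _ (pow_ne_zero 2 (mul_ne_zero ha hc))]

/-- The pairs of vectors that are orthonormal for the Euclidean inner product. -/
def orthonormalPairs : Set (E4 × E4) :=
  {p | ‖p.1‖ = 1 ∧ ‖p.2‖ = 1 ∧ inner ℝ p.1 p.2 = 0}

theorem isCompact_orthonormalPairs : IsCompact orthonormalPairs := by
  refine ((isCompact_sphere (0 : E4) 1).prod (isCompact_sphere (0 : E4) 1)).of_isClosed_subset ?_ ?_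
  · exact (isClosed_eq (by fun_prop) continuous_const).inter
      ((isClosed_eq (by fun_prop) continuous_const).inter
        (isClosed_eq (by fun_prop) continuous_const))
  · rintro p ⟨h1, h2, -⟩
    simp [h1, h2]

/-- Together with `sectional_triangular` this replaces the noncompact set of independent pairs by
the compact set of Euclidean-orthonormal ones, a set that does not depend on the metric. -/
theorem exists_orthonormalPair {u v : E4} (h : LinearIndependent ℝ ![u, v]) :
    ∃ p ∈ orthonormalPairs, ∃ a b c : ℝ, a ≠ 0 ∧ c ≠ 0 ∧ u = a • p.1 ∧
      v = b • p.1 + c • p.2 := by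
  rw [LinearIndependent.pair_iff] at h
  have hu : u ≠ 0 := by
    rintro rfl
    simpa using h 1 0 (by simp)
  have hn : ‖u‖ ≠ 0 := norm_ne_zero_iff.2 hu
  set u' := ‖u‖⁻¹ • u with hu'
  set b := inner ℝ u' v with hb
  have hw : v - b • u' ≠ 0 := fun h0 => by
    have := h (-(b * ‖u‖⁻¹)) 1 (by rw [← h0, hu']; module)
    simpa using this.2
  have hwn : ‖v - b • u'‖ ≠ 0 := norm_ne_zero_iff.2 hw
  have h1 : ‖u'‖ = 1 := by
    rw [hu', norm_smul, norm_inv, norm_norm, inv_mul_cancel₀ hn]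
  refine ⟨(u', ‖v - b • u'‖⁻¹ • (v - b • u')), ⟨h1, ?_, ?_⟩, ‖u‖, b, ‖v - b • u'‖, hn, hwn, ?_, ?_⟩
  · rw [norm_smul, norm_inv, norm_norm, inv_mul_cancel₀ hwn]
  · rw [inner_smul_right, inner_sub_right, inner_smul_right, real_inner_self_eq_norm_sq, h1]
    simp [hb]
  · rw [hu', smul_inv_smul₀ hn]
  · rw [smul_inv_smul₀ hwn]
    abel

theorem RegularMetricAt.continuousAt_sectional (h : RegularMetricAt G y) (hG : ContDiff ℝ ∞ G)
    (hs : ∀ z v w, G z v w = G z w v) (hpos : ∀ᶠ z in 𝓝 y, ∀ v ≠ 0, 0 < G z v v) {p : E4 × E4}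
    (hp : G y p.1 p.1 * G y p.2 p.2 - G y p.1 p.2 ^ 2 ≠ 0) :
    ContinuousAt (fun q : E4 × E4 × E4 => sectional G q.1 q.2.1 q.2.2) (y, p) := by
  have h1 : (fun q : E4 × E4 × E4 => sectional G q.1 q.2.1 q.2.2) =ᶠ[𝓝 (y, p)] fun q =>
      G q.1 (riemannMap G q.1 q.2.1 q.2.2 q.2.2) q.2.1 /
        (G q.1 q.2.1 q.2.1 * G q.1 q.2.2 q.2.2 - G q.1 q.2.1 q.2.2 ^ 2) := by
    filter_upwards [(continuous_fst.tendsto (y, p)).eventually hpos] with q hq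
    rw [sectional, (regularMetricAt_of_contDiff hG hs hq).riemann_eq]
  refine ContinuousAt.congr ?_ h1.symm
  have hR : ContinuousAt (fun q : E4 × E4 × E4 => riemannMap G q.1) (y, p) :=
    ContinuousAt.comp (f := Prod.fst) (g := riemannMap G) h.continuousAt_riemannMap continuousAt_fst
  have hg : Continuous fun q : E4 × E4 × E4 => G q.1 := hG.continuous.comp continuous_fst
  have hg := hg.continuousAt (x := (y, p))
  have h21 : ContinuousAt (fun q : E4 × E4 × E4 => q.2.1) (y, p) := by fun_prop
  have h22 : ContinuousAt (fun q : E4 × E4 × E4 => q.2.2) (y, p) := by fun_prop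
  refine ContinuousAt.div ?_ ?_ hp
  · exact (hg.clm_apply (((hR.clm_apply h21).clm_apply h22).clm_apply h22)).clm_apply h21
  · exact (((hg.clm_apply h21).clm_apply h21).mul ((hg.clm_apply h22).clm_apply h22)).sub
      (((hg.clm_apply h21).clm_apply h22).pow 2)

end SectionalCurvature

/-! ### Pinching near the origin and failure of definiteness at it. -/

section ExampleCurvature

set_option maxSynthPendingDepth 4

theorem exampleMetric_symm (τ : ℝ) (y v w : E4) : exampleMetric τ y v w = exampleMetric τ y w v := by
  simp [exampleMetric, quadraticMetric, exampleJet_symm τ y y v w, euclideanForm_apply,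
    real_inner_comm]

theorem eventually_exampleMetric_pos (τ : ℝ) :
    ∀ᶠ y in 𝓝 0, ∀ v, ‖v‖ ^ 2 / 2 ≤ exampleMetric τ y v v := by
  have hc : ContinuousAt (exampleMetric τ) 0 := contDiff_quadraticMetric.continuous.continuousAt
  filter_upwards [Metric.continuousAt_iff'.1 hc (1 / 2) (by norm_num)] with y hy v
  rw [dist_eq_norm, exampleMetric_zero] at hy
  have h1 : |(exampleMetric τ y - euclideanForm) v v| ≤ 1 / 2 * ‖v‖ * ‖v‖ :=
    ((exampleMetric τ y - euclideanForm).le_opNorm₂ v v).trans (by gcongr)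
  have h2 : (exampleMetric τ y - euclideanForm) v v = exampleMetric τ y v v - ‖v‖ ^ 2 := by
    rw [_root_.sub_apply, _root_.sub_apply, euclideanForm_apply, real_inner_self_eq_norm_sq]
  rw [h2] at h1
  nlinarith [(abs_le.1 h1).1]

theorem eventually_exampleMetric_pos' (τ : ℝ) :
    ∀ᶠ y in 𝓝 0, ∀ v ≠ 0, 0 < exampleMetric τ y v v := by
  filter_upwards [eventually_exampleMetric_pos τ] with y hy v hv
  have := norm_pos_iff.2 hv
  exact lt_of_lt_of_le (by positivity) (hy v)

theorem area_orthonormalPair {p : E4 × E4} (hp : p ∈ orthonormalPairs) :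
    (inner ℝ p.1 p.1 * inner ℝ p.2 p.2 - inner ℝ p.1 p.2 ^ 2 : ℝ) = 1 := by
  rw [real_inner_self_eq_norm_sq, real_inner_self_eq_norm_sq, hp.1, hp.2.1, hp.2.2]
  norm_num

/-- At the origin all ratios are at least `2/5 > K`. These strict inequalities persist near each
pair of planes, and compactness of the set of such pairs makes the neighbourhood of the origin
uniform. -/
theorem eventually_pinched {τ : ℝ} (hτ : τ ^ 2 = 1) {K : ℝ} (hK : K < 2 / 5) :
    ∀ᶠ y in 𝓝 0, ∀ u v u' v', LinearIndependent ℝ ![u, v] → LinearIndependent ℝ ![u', v'] →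
      0 < τ * sectional (exampleMetric τ) y u v ∧
        K < sectional (exampleMetric τ) y u v / sectional (exampleMetric τ) y u' v' := by
  have hreg : RegularMetricAt (exampleMetric τ) 0 :=
    regularMetricAt_quadraticMetric (exampleJet_symm τ)
  have hpos := eventually_exampleMetric_pos' τ
  have hτ0 : τ ≠ 0 := by
    rintro rfl
    norm_num at hτ
  have hval : ∀ p ∈ orthonormalPairs, ∃ s : ℝ, 1 ≤ s ∧ s ≤ 5 / 2 ∧
      sectional (exampleMetric τ) 0 p.1 p.2 = τ * s := by
    intro p hp
    have h1 := kahlerForm_sq_le p.1 p.2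
    rw [area_orthonormalPair hp] at h1
    refine ⟨5 / 2 - 3 / 2 * kahlerForm p.1 p.2 ^ 2, by linarith, ?_, ?_⟩
    · nlinarith [sq_nonneg (kahlerForm p.1 p.2)]
    · rw [sectional_exampleMetric, area_orthonormalPair hp]
      ring
  have hcont : ∀ p ∈ orthonormalPairs, ContinuousAt
      (fun q : E4 × E4 × E4 => sectional (exampleMetric τ) q.1 q.2.1 q.2.2) (0, p) := by
    intro p hp
    refine hreg.continuousAt_sectional contDiff_quadraticMetric (exampleMetric_symm τ) hpos ?_
    rw [exampleMetric_zero]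
    simp only [euclideanForm_apply]
    rw [area_orthonormalPair hp]
    norm_num
  have key : ∀ᶠ y in 𝓝 0, ∀ pq ∈ orthonormalPairs ×ˢ orthonormalPairs,
      0 < τ * sectional (exampleMetric τ) y pq.1.1 pq.1.2 ∧
        K < sectional (exampleMetric τ) y pq.1.1 pq.1.2
          / sectional (exampleMetric τ) y pq.2.1 pq.2.2 := by
    refine (isCompact_orthonormalPairs.prod
      isCompact_orthonormalPairs).eventually_forall_of_forall_eventually ?_
    rintro ⟨p, q⟩ ⟨hp, hq⟩
    have c1 : ContinuousAt (fun z : E4 × (E4 × E4) × (E4 × E4) =>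
        sectional (exampleMetric τ) z.1 z.2.1.1 z.2.1.2) (0, p, q) :=
      ContinuousAt.comp (f := fun z : E4 × (E4 × E4) × (E4 × E4) => (z.1, z.2.1))
        (x := (0, p, q)) (hcont p hp) (by fun_prop)
    have c2 : ContinuousAt (fun z : E4 × (E4 × E4) × (E4 × E4) =>
        sectional (exampleMetric τ) z.1 z.2.2.1 z.2.2.2) (0, p, q) :=
      ContinuousAt.comp (f := fun z : E4 × (E4 × E4) × (E4 × E4) => (z.1, z.2.2))
        (x := (0, p, q)) (hcont q hq) (by fun_prop)
    obtain ⟨s, hs1, hs2, hs⟩ := hval p hp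
    obtain ⟨t, ht1, ht2, ht⟩ := hval q hq
    have ht0 : sectional (exampleMetric τ) 0 q.1 q.2 ≠ 0 := by
      rw [ht]
      exact mul_ne_zero hτ0 (by linarith)
    have e1 := (continuousAt_const.mul c1 (x := (0, p, q)) (f := fun _ => τ)).eventually
      (lt_mem_nhds (a := 0) (by
        change 0 < τ * sectional (exampleMetric τ) 0 p.1 p.2
        rw [hs]
        nlinarith))
    have e2 := (c1.div c2 ht0).eventually (lt_mem_nhds (a := K) (by
        change K < sectional (exampleMetric τ) 0 p.1 p.2 / sectional (exampleMetric τ) 0 q.1 q.2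
        rw [hs, ht, mul_div_mul_left _ _ hτ0]
        refine hK.trans_le ?_
        rw [le_div_iff₀ (by linarith)]
        linarith))
    exact e1.and e2
  filter_upwards [key, hpos] with y hy hpy u v u' v' huv huv'
  have hregy := regularMetricAt_of_contDiff contDiff_quadraticMetric (exampleMetric_symm τ) hpy
  obtain ⟨p, hp, a, b, c, ha, hc, rfl, rfl⟩ := exists_orthonormalPair huv
  obtain ⟨q, hq, a', b', c', ha', hc', rfl, rfl⟩ := exists_orthonormalPair huv'
  rw [hregy.sectional_triangular ha hc, hregy.sectional_triangular ha' hc']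
  exact hy (p, q) ⟨hp, hq⟩

/-- At the centre one component of the curvature of `Λ⁺` is zero, so the image has dimension less
than three and no sign is possible. -/
theorem exists_example {τ : ℝ} (hτ : τ ^ 2 = 1) {K : ℝ} (hK : K < 2 / 5) :
    ∃ (X : Type) (_ : TopologicalSpace X) (_ : T2Space X) (_ : SecondCountableTopology X)
      (_ : ChartedSpace E4 X) (_ : IsManifold (𝓡 4) ∞ X) (g : RMetric X)
      (o : ManifoldOrientation X),
      (∀ x u v, LinearIndependent ℝ ![u, v] → 0 < τ * sec g x u v) ∧ IsPinched g K ∧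
        ∀ s, ¬ InducesDefinite g o 1 s := by
  obtain ⟨ρ, hρ, hball⟩ := Metric.eventually_nhds_iff_ball.1
    ((eventually_pinched hτ hK).and (eventually_exampleMetric_pos τ))
  have : Fact (0 < ρ) := ⟨hρ⟩
  have hcd : ContDiff ℝ ∞ (exampleMetric τ) := contDiff_quadraticMetric
  let g : RMetric (BallE4 ρ) := ballMetric (exampleMetric τ) hcd (exampleMetric_symm τ)
    fun y hy => (hball y hy).2
  have hgerm : ∀ x : BallE4 ρ, coordMetric g x =ᶠ[𝓝 x.val] exampleMetric τ := fun x => by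
    filter_upwards [Metric.isOpen_ball.mem_nhds x.val_mem] with y hy
    exact coordMetric_ballMetric x hy
  have hreg : ∀ x : BallE4 ρ, RegularMetricAt (coordMetric g x) x.val :=
    fun x => regularMetricAt_coordMetric g x
  have hreg' : ∀ x : BallE4 ρ, RegularMetricAt (exampleMetric τ) x.val := fun x =>
    regularMetricAt_of_contDiff hcd (exampleMetric_symm τ) fun v hv => by
      have := norm_pos_iff.2 hv
      exact lt_of_lt_of_le (by positivity) ((hball x.val x.val_mem).2 v)
  have hsec : ∀ (x : BallE4 ρ) u v, sec g x u v = sectional (exampleMetric τ) x.val u v :=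
    fun x u v => sectional_congr (hgerm x) (hreg x) (hreg' x) u v
  refine ⟨BallE4 ρ, inferInstance, inferInstance, inferInstance, inferInstance, inferInstance, g,
    ballOrientation, fun x u v h => ?_, fun x u v u' v' h h' => ?_, fun s hs => ?_⟩
  · rw [hsec]
    exact ((hball x.val x.val_mem).1 u v u v h h).1
  · rw [hsec, hsec]
    exact ((hball x.val x.val_mem).1 u v u' v' h h').2
  · set e := (EuclideanSpace.basisFun (Fin 4) ℝ).toBasis with he
    have hval : coordMetric g BallE4.center (BallE4.center : BallE4 ρ).val = euclideanForm := by
      rw [(hgerm _).eq_of_nhds]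
      exact exampleMetric_zero τ
    have hon : ∀ i j, coordMetric g BallE4.center (BallE4.center : BallE4 ρ).val (e i) (e j)
        = if i = j then 1 else 0 := fun i j => by
      rw [hval, euclideanForm_apply]
      have := (EuclideanSpace.basisFun (Fin 4) ℝ).inner_eq_ite i j
      simpa [he] using this
    obtain ⟨F, hF, -, hsign⟩ := hs BallE4.center e ⟨hon, rfl⟩
    refine not_hasSign (φ := so3Basis.coord 0) ?_ (fun u v => ?_) s hsign
    · intro h0
      have := congrArg (fun L => L (so3Basis 0)) h0
      simp at this
    · have h1 := hF u v 1 (e 0) (e 3)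
      have h2 := formCurvature_dualFrame (hreg BallE4.center) hon u v 1 (e 0) (e 3)
      have h3 := h1.symm.trans h2
      have h4 : ∀ i, dualFrame e 1 i (e 0) (e 3) = if i = 2 then 1 else 0 := fun i => by
        fin_cases i <;> simp [dualFrame, wedgeCovectors]
      simp only [h4, mul_ite, mul_one, mul_zero, Finset.sum_ite_eq', Finset.mem_univ, if_true] at h3
      have h5 : curvatureForm (coordMetric g BallE4.center) (BallE4.center : BallE4 ρ).val 1
          = curvatureForm (exampleMetric τ) 0 1 := by
        ext w z u v
        rw [curvatureForm_apply, curvatureForm_apply, riemannMap_congr (hgerm _),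
          (hgerm _).eq_of_nhds]
        rfl
      change so3Basis.repr (F u v) 0 = 0
      rw [so3Basis, Module.Basis.ofEquivFun_repr_apply]
      change (F u v : Matrix (Fin 3) (Fin 3) ℝ) 2 1 = 0
      rw [h3, coe_curvatureOfForms, h5]
      simp [crossMat, he, dualCurvature_exampleMetric]

end ExampleCurvature

end PinchedConnections

end

theorem mainTheorem5 :
    (∀ (X : Type*) [TopologicalSpace X] [ChartedSpace PinchedConnections.E4 X]
      [IsManifold (𝓡 4) ∞ X] (g : PinchedConnections.RMetric X)
      (o : PinchedConnections.ManifoldOrientation X),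
      PinchedConnections.PositiveCurvature g → PinchedConnections.IsPinched g (2 / 5) →
        PinchedConnections.InducesPositiveDefinite g o) ∧
    (∀ (X : Type*) [TopologicalSpace X] [ChartedSpace PinchedConnections.E4 X]
      [IsManifold (𝓡 4) ∞ X] (g : PinchedConnections.RMetric X)
      (o : PinchedConnections.ManifoldOrientation X),
      PinchedConnections.NegativeCurvature g → PinchedConnections.IsPinched g (2 / 5) →
        PinchedConnections.InducesNegativeDefinite g o) ∧
    (∀ K : ℝ, K < 2 / 5 →
      ∃ (X : Type) (_ : TopologicalSpace X) (_ : T2Space X) (_ : SecondCountableTopology X)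
        (_ : ChartedSpace PinchedConnections.E4 X) (_ : IsManifold (𝓡 4) ∞ X)
        (g : PinchedConnections.RMetric X) (o : PinchedConnections.ManifoldOrientation X),
        PinchedConnections.PositiveCurvature g ∧ PinchedConnections.IsPinched g K ∧
          ¬ PinchedConnections.InducesPositiveDefinite g o) ∧
    (∀ K : ℝ, K < 2 / 5 →
      ∃ (X : Type) (_ : TopologicalSpace X) (_ : T2Space X) (_ : SecondCountableTopology X)
        (_ : ChartedSpace PinchedConnections.E4 X) (_ : IsManifold (𝓡 4) ∞ X)
        (g : PinchedConnections.RMetric X) (o : PinchedConnections.ManifoldOrientation X),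
        PinchedConnections.NegativeCurvature g ∧ PinchedConnections.IsPinched g K ∧
          ¬ PinchedConnections.InducesNegativeDefinite g o) := by
  refine ⟨fun X _ _ _ g o => PinchedConnections.inducesPositiveDefinite_of_pinched o,
    fun X _ _ _ g o => PinchedConnections.inducesNegativeDefinite_of_pinched o,
    fun K hK => ?_, fun K hK => ?_⟩
  · obtain ⟨X, i1, i2, i3, i4, i5, g, o, hsec, hpinch, hnot⟩ :=
      PinchedConnections.exists_example (τ := 1) (by norm_num) hK
    exact ⟨X, i1, i2, i3, i4, i5, g, o, fun x u v h => by simpa using hsec x u v h, hpinch,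
      fun h => hnot 1 h.1⟩
  · obtain ⟨X, i1, i2, i3, i4, i5, g, o, hsec, hpinch, hnot⟩ :=
      PinchedConnections.exists_example (τ := -1) (by norm_num) hK
    exact ⟨X, i1, i2, i3, i4, i5, g, o, fun x u v h => by simpa using hsec x u v h, hpinch,
      fun h => hnot (-1) h.1⟩
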